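/- Let $n$ facilities $1,\dots,n$ choose locations $s_1,\dots,s_n\in[0,1]$ and let every client $z\in[0,1]$ choose one facility. A client mapping $c:[0,1]\to\{1,\dots,n\}$ is called measurable if the clients of each facility form a finite union of intervals, and proper if they form a single nonempty interval for each facility. The load (which is also the utility) $\ell_i(c)$ of facility $i$ is the total length of the set of clients choosing $i$. For $\alpha\in[0,1]$ the cost of client $z$ is $(1-\alpha)\,|s_{c(z)}-z|+\alpha\,\ell_{c(z)}(c)$. A measurable mapping is a client equilibrium for $s$ if no single client can lower her cost by choosing another facility. A client strategy $f$ assigns a client mapping $f(t,\cdot)$ to every location vector $t\in[0,1]^n$. For $\rho\ge 1$, the pair $(s,f)$ is a $\rho$-approximate pure subgame perfect equilibrium ($\rho$-SPE) if (1) $u_i\big((s_{-i},s_i'),f\big)\le\rho\,u_i(s,f)$ for every facility $i$ and every $s_i'\in[0,1]$, where $u_i(t,f)=\ell_i(f(t,\cdot))$, and (2) $f(t,\cdot)$ is a client equilibrium for every $t\in[0,1]^n$. Write $n=2k$ or $n=2k-1$ and let $p_{2i-1}=p_{2i}=\frac{2i-1}{2k}$ for $1\le i\le k$. The Eaton–Lipsey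 placement is $s_{\mathrm{pair}}=(p_1,\dots,p_n)$ if $n=2k$, and $s_{\mathrm{pair}}=(p_1,\dots,p_k,p_{k+2},\dots,p_{n+1})$ if $n=2k-1$. Put $$\rho_4=\tfrac{4+\alpha-\alpha^2}{4},\qquad \rho_5=\tfrac{(4+\alpha)(\alpha(\alpha(3+\alpha)-3)-4)}{(2+\alpha)(\alpha(5\alpha-2)-8)},\qquad \rho_6=\tfrac{\alpha(4-\alpha(\alpha-7))-16}{2(\alpha(4+\alpha)-8)},$$ $$\rho_7=\tfrac{(64-64\alpha+7\alpha^3)(16+\alpha(2+\alpha)(\alpha(\alpha-3)-2))}{2(32+\alpha(\alpha(\alpha-10)-16))(16+\alpha(\alpha-16+\alpha^2))},\qquad \rho_8=\tfrac{64-\alpha(48+\alpha(24+(\alpha-17)\alpha))}{4(16+\alpha(\alpha-16+\alpha^2))},$$ $$\rho_9=\tfrac{(32+(\alpha-4)\alpha(2+\alpha)(1+2\alpha))(\alpha(4+3\alpha)-16)}{(\alpha-2)(4+\alpha)(64+\alpha(\alpha(\alpha-24)-32))},\qquad \rho_{10}=\tfrac{\alpha(320-\alpha(\alpha(120+(\alpha-31)\alpha)-16))-256}{2(\alpha(\alpha-4)(\alpha(4+3\alpha)-48)-128)}.$$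 Theorem. Let $4\le n\le 10$ and $\alpha\in[0,1]$. Then $s_{\mathrm{pair}}$ yields a $\rho_n(\alpha)$-SPE. Precisely: there is a client strategy $f$, proper at every location vector and giving equal loads to co-located facilities, such that $(s_{\mathrm{pair}},f)$ is a $\rho_n(\alpha)$-SPE; and $(s_{\mathrm{pair}},f)$ is a $\rho_n(\alpha)$-SPE for every client strategy $f$ that is a client equilibrium at every location vector, where for $\alpha=0$ it is in addition assumed that under $f$ co-located facilities always have equal loads. Moreover $\rho_n(\alpha)\le 1.08665$. -/

import Mathlib

open MeasureTheory

namespace KohlbergGame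

/-- A facility location vector `s = (s_1, …, s_n)` with every `s_i ∈ [0,1]`. -/
abbrev Placement (n : ℕ) : Type := Fin n → unitInterval

/-- The choices of all clients `z ∈ [0,1]` for one fixed facility location vector. -/
abbrev ClientChoice (n : ℕ) : Type := unitInterval → Fin n

/-- A client choice function `f`, giving a choice of all clients for every location vector. -/
abbrev ClientStrategy (n : ℕ) : Type := Placement n → ClientChoice n

/-- A measurable client mapping: the clients of every facility form a finite union of
intervals (possibly degenerate ones). -/
def IsMeasurableMapping {n : ℕ} (c : ClientChoice n) : Prop :=
  ∀ i : Fin n, ∃ J : Set (Set unitInterval),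
    J.Finite ∧ (∀ I ∈ J, I.OrdConnected) ∧ {z | c z = i} = ⋃₀ J

/-- A proper client mapping: the clients of every facility form a single nonempty interval. -/
def IsProperMapping {n : ℕ} (c : ClientChoice n) : Prop :=
  ∀ i : Fin n, {z | c z = i}.Nonempty ∧ {z | c z = i}.OrdConnected

/-- The load of facility `i`: the total length of the set of her clients.  It is also the
utility of facility `i`. -/
noncomputable def load {n : ℕ} (c : ClientChoice n) (i : Fin n) : ℝ :=
  volume.real {z : unitInterval | c z = i}

/-- The cost of the client `z`. -/
noncomputable def clientCost {n : ℕ} (α : ℝ) (s : Placement n) (c : ClientChoice n)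
    (z : unitInterval) : ℝ :=
  (1 - α) * |(s (c z) : ℝ) - (z : ℝ)| + α * load c (c z)

/-- A client equilibrium for the location vector `s`: a measurable client mapping in which no
single client can decrease her cost by choosing another facility. -/
def IsClientEquilibrium {n : ℕ} (α : ℝ) (s : Placement n) (c : ClientChoice n) : Prop :=
  IsMeasurableMapping c ∧
    ∀ (z : unitInterval) (j : Fin n),
      clientCost α s c z ≤ clientCost α s (Function.update c z j) z

/-- Co-located facilities have equal loads. -/
def SharesTies {n : ℕ} (s : Placement n) (c : ClientChoice n) : Prop :=
  ∀ i j : Fin n, s i = s j → load c i = load c j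

/-- `(s, f)` is a `ρ`-approximate pure subgame perfect equilibrium: no facility can increase
her utility by more than the factor `ρ`, and the clients are in equilibrium for every
location vector. -/
def IsApproxSPE {n : ℕ} (α ρ : ℝ) (s : Placement n) (f : ClientStrategy n) : Prop :=
  (∀ (i : Fin n) (x : unitInterval),
      load (f (Function.update s i x)) i ≤ ρ * load (f s) i) ∧
    ∀ t : Placement n, IsClientEquilibrium α t (f t)

/-- The number `k` with `n = 2k` or `n = 2k - 1`. -/
def numPairs (n : ℕ) : ℕ := (n + 1) / 2

/-- The zero-based position, in the list of `2k` paired locations, of the facility with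
zero-based number `j`: for odd `n`, the location with zero-based position `k` is left out. -/
def pairIndex (n j : ℕ) : ℕ := if Even n ∨ j < numPairs n then j else j + 1

theorem pairIndex_lt {n j : ℕ} (h : j < n) : pairIndex n j < 2 * numPairs n := by
  unfold pairIndex numPairs
  split_ifs with h'
  · omega
  · have : ¬ Even n := fun he => h' (Or.inl he)
    rw [Nat.not_even_iff] at this
    omega

/-- The Eaton–Lipsey placement: among the `2k` locations that in zero-based numbering
`m = 0, …, 2k-1` are `(2⌊m/2⌋ + 1) / (2k)`, all are taken if `n = 2k`, and all but the one
with `m = k` if `n = 2k - 1`. -/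
noncomputable def sPair (n : ℕ) : Placement n := fun j =>
  ⟨(2 * ((pairIndex n j / 2 : ℕ) : ℝ) + 1) / (2 * (numPairs n : ℝ)), by
    have h := pairIndex_lt j.isLt
    have h2 : pairIndex n j / 2 + 1 ≤ numPairs n := by omega
    have h3 : ((pairIndex n j / 2 : ℕ) : ℝ) + 1 ≤ (numPairs n : ℝ) := by exact_mod_cast h2
    have h4 : (0 : ℝ) ≤ ((pairIndex n j / 2 : ℕ) : ℝ) := Nat.cast_nonneg _
    refine ⟨by positivity, ?_⟩
    rw [div_le_one (by linarith)]
    linarith⟩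

/-- The approximation factors `ρ_n(α)` for `4 ≤ n ≤ 10`; the value for other `n` plays no
role. -/
noncomputable def rho (n : ℕ) (a : ℝ) : ℝ :=
  match n with
  | 4 => (4 + a - a ^ 2) / 4
  | 5 => ((4 + a) * (a * (a * (3 + a) - 3) - 4)) / ((2 + a) * (a * (5 * a - 2) - 8))
  | 6 => (a * (4 - a * (a - 7)) - 16) / (2 * (a * (4 + a) - 8))
  | 7 => ((64 - 64 * a + 7 * a ^ 3) * (16 + a * (2 + a) * (a * (a - 3) - 2))) /
      (2 * (32 + a * (a * (a - 10) - 16)) * (16 + a * (a - 16 + a ^ 2)))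
  | 8 => (64 - a * (48 + a * (24 + (a - 17) * a))) / (4 * (16 + a * (a - 16 + a ^ 2)))
  | 9 => ((32 + (a - 4) * a * (2 + a) * (1 + 2 * a)) * (a * (4 + 3 * a) - 16)) /
      ((a - 2) * (4 + a) * (64 + a * (a * (a - 24) - 32)))
  | 10 => (a * (320 - a * (a * (120 + (a - 31) * a) - 16)) - 256) /
      (2 * (a * (a - 4) * (a * (4 + 3 * a) - 48) - 128))
  | _ => 1

end KohlbergGame

namespace KohlbergGame

/-! ### One-sided chains of facilities -/

/-! Let α > 0 and β = (1 - α) / α. After division of costs by α, the client between two consecutive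
facilities is indifferent exactly when their loads differ by β times the difference of her
distances; this is `Balanced`. Given the first load, these equations determine all breakpoints, and
the last one grows continuously with it, so a solution exists (`exists_balanced`). Its loads are
positive and it yields a client equilibrium (`Balanced.isSolution`, `IsSolution.exists_choice`).
Equilibrium loads are unique (`IsClientEquilibrium.load_eq`), so only one balanced sequence per
location vector has to be studied.

When a facility moves, the facilities on each side of her form a chain that shares the clients
between a wall and a boundary. Everything rests on the fact that |q - z| - |p - z| is nondecreasing
in z for q ≤ p. It carries upper bounds for the load of the innermost facility, affine in the
boundary, along a chain (`ChainLE.cons`, `AffineBound.cons`). If the mover had load above B, one of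
the boundaries would be pushed behind a chosen comparison boundary; the neighbor there would have a
small load, and indifference would force the mover's load down to B (`gap_load_le`, `wall_load_le`).
With B equal to the factor times the old load (`load_sPair`) and lengths in units of 1 / (2k), the
side conditions are sign conditions on integer polynomials in β ≥ 0. They hold coefficientwise, and
the finitely many cases are evaluated in `moveCheck_all`.

For α = 0 equilibria are limits of equilibria with α → 0 (`isSolution_zero_of_tendsto`), and equal
loads at ties restore uniqueness, so the estimate passes to the limit. The numerical bound on the
factors is again a polynomial inequality in β (`rhoNum_le`). -/

theorem abs_sub_abs_mono {p q y z : ℝ} (hpq : q ≤ p) (hyz : y ≤ z) :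
    |q - y| - |p - y| ≤ |q - z| - |p - z| := by
  rcases abs_cases (q - y) with h1 | h1 <;> rcases abs_cases (p - y) with h2 | h2 <;>
    rcases abs_cases (q - z) with h3 | h3 <;> rcases abs_cases (p - z) with h4 | h4 <;> linarith

/-- `Chain β l y m` : facilities at the positions `l` (listed from right to left) share the clients
in `[0, y]`, all clients at common boundaries being indifferent, and the rightmost facility has
load `m`. -/
def Chain (β : ℝ) : List ℤ → ℝ → ℝ → Prop
  | [], _, _ => False
  | [_], y, m => y = m
  | p :: q :: l, y, m =>
      ∃ m' : ℝ, Chain β (q :: l) (y - m) m' ∧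
        m = m' + β * (|(q : ℝ) - (y - m)| - |(p : ℝ) - (y - m)|)

/-- In every chain over `l` with right boundary at most `y`, the rightmost load is at most `m`. -/
def ChainLE (β : ℝ) (l : List ℤ) (y m : ℝ) : Prop :=
  ∀ y' m' : ℝ, Chain β l y' m' → y' ≤ y → m' ≤ m

theorem chainLE_singleton (β : ℝ) (p : ℤ) (y : ℝ) : ChainLE β [p] y y := by
  intro y' m' h hy
  have h : y' = m' := h
  linarith

/-- A last load above `m₁` would leave less than `y` to the rest of the chain. The preceding load
would then be at most `m`, and indifference with monotonicity of the distance difference would bring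
the last load down to `m₁`. -/
theorem ChainLE.cons {β : ℝ} (hβ : 0 ≤ β) {p q : ℤ} (hqp : q ≤ p) {l : List ℤ} {y m m₁ : ℝ}
    (h : ChainLE β (q :: l) y m) (hm : m + β * (|(q : ℝ) - y| - |(p : ℝ) - y|) ≤ m₁) :
    ChainLE β (p :: q :: l) (y + m₁) m₁ := by
  rintro y' m' ⟨m'', hc, he⟩ hy
  by_contra! hlt
  have h1 : y' - m' ≤ y := by linarith
  have h2 := h _ _ hc h1
  have h3 := abs_sub_abs_mono (p := (p : ℝ)) (q := q) (by exact_mod_cast hqp) h1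
  linarith [mul_le_mul_of_nonneg_left h3 hβ]

/-- The load of the last facility of a chain with last position `p` is at most `a + b * δ` if
the boundary is at most `p + δ`, for `δ ∈ [lo, hi]`. -/
def AffineBound (β : ℝ) (l : List ℤ) (a b lo hi : ℝ) : Prop :=
  ∀ δ : ℝ, lo ≤ δ → δ ≤ hi → ChainLE β l ((l.headD 0 : ℤ) + δ) (a + b * δ)

theorem affineBound_singleton (β : ℝ) (p : ℤ) (lo hi : ℝ) : AffineBound β [p] p 1 lo hi := by
  intro δ _ _
  simpa using chainLE_singleton β p (p + δ)

/-- The convex function |δ| - |p - q - δ| is majorized on `[lo', hi']` by the line κδ - μ. The new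
boundary, relative to `p`, is then an increasing affine function of `δ` with slope 1 + b + κβ;
inverting it gives the new coefficients and range. -/
theorem AffineBound.cons {β : ℝ} (hβ : 0 ≤ β) {p q : ℤ} (hqp : q ≤ p) {l : List ℤ}
    {a b lo hi κ μ lo' hi' a' b' lo'' hi'' : ℝ} (h : AffineBound β (q :: l) a b lo hi)
    (hb : 0 < 1 + (b + κ * β)) (hlo : lo ≤ lo') (hhi : hi' ≤ hi)
    (hφ : ∀ δ : ℝ, lo' ≤ δ → δ ≤ hi' → |δ| - |(p : ℝ) - q - δ| ≤ κ * δ - μ)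
    (ha' : a' * (1 + (b + κ * β)) = a - μ * β + (b + κ * β) * (p - q))
    (hb' : b' * (1 + (b + κ * β)) = b + κ * β)
    (hlo'' : a - μ * β - (p - q) + (1 + (b + κ * β)) * lo' ≤ lo'')
    (hhi'' : hi'' ≤ a - μ * β - (p - q) + (1 + (b + κ * β)) * hi') :
    AffineBound β (p :: q :: l) a' b' lo'' hi'' := by
  intro δ' h1 h2
  obtain ⟨δ, hδ⟩ : ∃ δ : ℝ, (1 + (b + κ * β)) * δ = δ' - (a - μ * β - (p - q)) :=
    ⟨(δ' - (a - μ * β - (p - q))) / (1 + (b + κ * β)), by field_simp⟩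
  have h3 : lo' ≤ δ := le_of_mul_le_mul_left (by linarith) hb
  have h4 : δ ≤ hi' := le_of_mul_le_mul_left (by linarith) hb
  have hm : a' + b' * δ' = (a + b * δ) + β * (κ * δ - μ) := by
    have : (a' + b' * δ') * (1 + (b + κ * β)) =
        ((a + b * δ) + β * (κ * δ - μ)) * (1 + (b + κ * β)) := by
      linear_combination ha' + δ' * hb' - (b + κ * β) * hδ
    exact mul_right_cancel₀ hb.ne' this
  have h5 := hφ δ h3 h4
  have := (h δ (hlo.trans h3) (h4.trans hhi)).cons hβ hqp (m₁ := a' + b' * δ') (by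
    rw [hm]
    have e1 : |(q : ℝ) - (((q :: l).headD 0 : ℤ) + δ)| = |δ| := by
      simp [abs_neg]
    have e2 : (p : ℝ) - (((q :: l).headD 0 : ℤ) + δ) = p - q - δ := by
      simp; ring
    rw [e1, e2]
    linarith [mul_le_mul_of_nonneg_left h5 hβ])
  convert this using 1
  simp only [List.headD_cons]
  rw [hm]
  linarith

/-! ### The load of a facility between two chains -/

/-- The mover is at distance `ξ` from the left neighbor, and the neighbors are `W` apart. Comparison
boundaries at distances `W - B - R` and `R` from them leave exactly `B`, so a larger load passes one
of the two. `R` is chosen affine in `ξ` so that the right estimate is an equality: `R₀` belongs to ξ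
= 0, `R₁` to ξ = W - R₁. The left estimate is convex along this path, so it is only needed at both
ends (`c₁` to `c₄`). -/
theorem gap_load_le {β W B ξ : ℝ} (hβ : 0 ≤ β) {P Q : ℝ → ℝ → Prop}
    {al bl lo hi ar br lor hir R₀ R₁ : ℝ}
    (hP : ∀ δ, lo ≤ δ → δ ≤ hi → ∀ δ' m, P δ' m → δ' ≤ δ → m ≤ al + bl * δ)
    (hQ : ∀ δ, lor ≤ δ → δ ≤ hir → ∀ δ' m, Q δ' m → δ' ≤ δ → m ≤ ar + br * δ)
    (hbr : 0 < br) (hlor : lor ≤ 0) (har : ar ≤ B)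
    (hR₀ : (br + 2 * β) * R₀ = B - ar + β * W) (hR₁ : (br + β) * R₁ = B - ar)
    (hR₀' : R₀ ≤ hir) (hR₁' : R₁ ≤ hir)
    (hl₀ : lo ≤ W - B - R₀) (hh₀ : W - B - R₀ ≤ hi)
    (hl₁ : lo ≤ W - B - R₁) (hh₁ : W - B - R₁ ≤ hi)
    (c₁ : al + bl * (W - B - R₀) ≤ B)
    (c₂ : al + bl * (W - B - R₀) + β * (2 * (W - B - R₀)) ≤ B)
    (c₃ : al + bl * (W - B - R₁) - β * (W - R₁) ≤ B)
    (c₄ : al + bl * (W - B - R₁) + β * (2 * (W - B - R₁) - (W - R₁)) ≤ B)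
    (hξ : 0 ≤ ξ) (hξW : ξ ≤ W) {δ ε m r : ℝ} (hPδ : P δ m) (hQε : Q ε r)
    (e₁ : W - δ - ε = m + β * (|δ| - |ξ - δ|))
    (e₂ : W - δ - ε = r + β * (|ε| - |W - ξ - ε|)) : W - δ - ε ≤ B := by
  have hR₁0 : 0 ≤ R₁ := by
    by_contra! h
    nlinarith
  have hR₀0 : 0 ≤ R₀ := by
    by_contra! h
    nlinarith [mul_nonneg hβ (hξ.trans hξW)]
  -- a pair of comparison boundaries suffices
  have key : ∀ y R M N : ℝ, y + R = W - B → (∀ δ' m, P δ' m → δ' ≤ y → m ≤ M) →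
      (∀ δ' m, Q δ' m → δ' ≤ R → m ≤ N) → M + β * (|y| - |ξ - y|) ≤ B →
      N + β * (|R| - |W - ξ - R|) ≤ B → W - δ - ε ≤ B := by
    intro y R M N hyR hM hN h1 h2
    by_contra! hlt
    rcases le_or_gt δ y with h | h
    · have := hM _ _ hPδ h
      have h3 := abs_sub_abs_mono (p := ξ) (q := 0) hξ h
      simp only [zero_sub, abs_neg] at h3
      linarith [mul_le_mul_of_nonneg_left h3 hβ]
    · have h' : ε ≤ R := by linarith
      have := hN _ _ hQε h'
      have h3 := abs_sub_abs_mono (p := W - ξ) (q := 0) (by linarith) h'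
      simp only [zero_sub, abs_neg] at h3
      linarith [mul_le_mul_of_nonneg_left h3 hβ]
  have absle : ∀ y z : ℝ, |y| - |z - y| ≤ 2 * y - z ∨ |y| - |z - y| ≤ - z := by
    intro y z
    rcases abs_cases y with h | h
    · left; linarith [neg_le_abs (z - y), le_abs_self (z - y)]
    · right; linarith [neg_le_abs (z - y), le_abs_self (z - y)]
  -- Beyond the end of the path `R₁` is kept: the right estimate then only uses |R₁|, and the left
  -- one improves as `ξ` grows.
  rcases le_or_gt (W - R₁) ξ with hx | hx
  · refine key _ R₁ _ _ (by ring) (hP _ hl₁ hh₁) (hQ _ (hlor.trans hR₁0) hR₁') ?_ ?_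
    · rcases absle (W - B - R₁) ξ with h | h
      · linarith [mul_le_mul_of_nonneg_left h hβ, mul_le_mul_of_nonneg_left hx hβ]
      · linarith [mul_le_mul_of_nonneg_left h hβ, mul_le_mul_of_nonneg_left hx hβ]
    · have : |R₁| - |W - ξ - R₁| ≤ R₁ := by
        rw [abs_of_nonneg hR₁0]; linarith [abs_nonneg (W - ξ - R₁)]
      linarith [mul_le_mul_of_nonneg_left this hβ]
  · have hX : 0 < W - R₁ := by linarith
    obtain ⟨θ, hθ⟩ : ∃ θ : ℝ, ξ = θ * (W - R₁) := ⟨ξ / (W - R₁), by field_simp⟩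
    have hθ0 : 0 ≤ θ := by
      by_contra! h
      nlinarith
    have hθ1 : θ ≤ 1 := by
      by_contra! h
      nlinarith
    have conv : ∀ u v c : ℝ, u ≤ c → v ≤ c → (1 - θ) * u + θ * v ≤ c := by
      intro u v c hu hv
      linarith [mul_le_mul_of_nonneg_left hu (sub_nonneg.2 hθ1),
        mul_le_mul_of_nonneg_left hv hθ0]
    have conv' : ∀ u v c : ℝ, c ≤ u → c ≤ v → c ≤ (1 - θ) * u + θ * v := by
      intro u v c hu hv
      linarith [mul_le_mul_of_nonneg_left hu (sub_nonneg.2 hθ1),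
        mul_le_mul_of_nonneg_left hv hθ0]
    set R := (1 - θ) * R₀ + θ * R₁ with hR
    have hR0 : 0 ≤ R := conv' _ _ _ hR₀0 hR₁0
    have hy : W - B - R = (1 - θ) * (W - B - R₀) + θ * (W - B - R₁) := by rw [hR]; ring
    refine key (W - B - R) R _ _ (by ring) (hP _ ?_ ?_)
      (hQ _ (hlor.trans hR0) (conv _ _ _ hR₀' hR₁')) ?_ ?_
    · rw [hy]; exact conv' _ _ _ hl₀ hl₁
    · rw [hy]; exact conv _ _ _ hh₀ hh₁
    · rcases absle (W - B - R) ξ with h | h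
      · have := conv _ _ _ c₂ c₄
        have h2 := mul_le_mul_of_nonneg_left h hβ
        rw [hy] at h2 ⊢
        rw [hθ] at h2 ⊢
        linarith
      · have := conv _ _ _ c₁ c₃
        have h2 := mul_le_mul_of_nonneg_left h hβ
        rw [hy] at h2 ⊢
        rw [hθ] at h2 ⊢
        linarith
    · have h3 : |R| - |W - ξ - R| ≤ 2 * R + ξ - W := by
        rw [abs_of_nonneg hR0]; linarith [le_abs_self (W - ξ - R)]
      have h4 := mul_le_mul_of_nonneg_left h3 hβ
      have h5 : ar + br * R + β * (2 * R + ξ - W) = B := by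
        rw [hR, hθ]
        linear_combination (1 - θ) * hR₀ + θ * hR₁
      linarith

/-- If the mover at `x ≤ s` served more than [0, B] with `s ≤ B`, the boundary would lie beyond both
facilities, where the mover is at least as far away as her neighbor. Her load would then be at most
the neighbor's, which is too small. -/
theorem wall_load_le {β B x s : ℝ} {Q : ℝ → ℝ → Prop} {ar br lo hi : ℝ} (hβ : 0 ≤ β)
    (hQ : ∀ δ, lo ≤ δ → δ ≤ hi → ∀ δ' m, Q δ' m → δ' ≤ δ → m ≤ ar + br * δ)
    (hB : s ≤ B) (hl : lo ≤ s - B) (hh : s - B ≤ hi) (hc : ar + br * (s - B) ≤ B)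
    (hx : x ≤ s) {L r : ℝ} (hQL : Q (s - L) r)
    (e : L = r + β * (|s - L| - |x - L|)) : L ≤ B := by
  by_contra! hlt
  have h1 := hQ _ hl hh _ _ hQL (by linarith)
  have h2 : |s - L| - |x - L| ≤ 0 := by
    rw [abs_of_nonpos (by linarith), abs_of_nonpos (by linarith)]; linarith
  linarith [mul_le_mul_of_nonneg_left h2 hβ]

/-! ### Integer polynomials as coefficient lists -/

/-- The value at `β` of the polynomial with the given coefficients, constant term first. -/
def peval (β : ℝ) : List ℤ → ℝ
  | [] => 0
  | c :: p => c + β * peval β p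

/-- Sum of polynomials. -/
def padd : List ℤ → List ℤ → List ℤ
  | [], q => q
  | c :: p, [] => c :: p
  | c :: p, d :: q => (c + d) :: padd p q

/-- Multiplication of a polynomial by a constant. -/
def psmul (c : ℤ) : List ℤ → List ℤ
  | [] => []
  | d :: p => (c * d) :: psmul c p

/-- Product of polynomials. -/
def pmul : List ℤ → List ℤ → List ℤ
  | [], _ => []
  | c :: p, q => padd (psmul c q) (0 :: pmul p q)

/-- Difference of polynomials. -/
def psub (p q : List ℤ) : List ℤ := padd p (psmul (-1) q)

/-- All coefficients are nonnegative. -/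
def pnonneg : List ℤ → Bool
  | [] => true
  | c :: p => decide (0 ≤ c) && pnonneg p

/-- The constant coefficient is positive and all others are nonnegative. -/
def ppos : List ℤ → Bool
  | [] => false
  | c :: p => decide (0 < c) && pnonneg p

@[simp] theorem peval_nil (β : ℝ) : peval β [] = 0 := rfl

@[simp] theorem peval_cons (β : ℝ) (c : ℤ) (p : List ℤ) :
    peval β (c :: p) = c + β * peval β p := rfl

@[simp] theorem peval_padd (β : ℝ) (p q : List ℤ) :
    peval β (padd p q) = peval β p + peval β q := by
  induction p generalizing q with
  | nil => simp [padd]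
  | cons c p ih =>
    cases q with
    | nil => simp [padd]
    | cons d q => simp [padd, ih]; ring

@[simp] theorem peval_psmul (β : ℝ) (c : ℤ) (p : List ℤ) :
    peval β (psmul c p) = c * peval β p := by
  induction p with
  | nil => simp [psmul]
  | cons d p ih => simp [psmul, ih]; ring

@[simp] theorem peval_pmul (β : ℝ) (p q : List ℤ) :
    peval β (pmul p q) = peval β p * peval β q := by
  induction p with
  | nil => simp [pmul]
  | cons c p ih => simp [pmul, ih]; ring

@[simp] theorem peval_psub (β : ℝ) (p q : List ℤ) :
    peval β (psub p q) = peval β p - peval β q := by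
  simp [psub]; ring

theorem peval_nonneg {β : ℝ} (hβ : 0 ≤ β) {p : List ℤ} (h : pnonneg p = true) :
    0 ≤ peval β p := by
  induction p with
  | nil => simp
  | cons c p ih =>
    simp only [pnonneg, Bool.and_eq_true, decide_eq_true_eq] at h
    have : (0 : ℝ) ≤ c := by exact_mod_cast h.1
    have := mul_nonneg hβ (ih h.2)
    simp only [peval_cons]; linarith

theorem peval_pos {β : ℝ} (hβ : 0 ≤ β) {p : List ℤ} (h : ppos p = true) : 0 < peval β p := by
  cases p with
  | nil => simp [ppos] at h
  | cons c p =>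
    simp only [ppos, Bool.and_eq_true, decide_eq_true_eq] at h
    have : (0 : ℝ) < c := by exact_mod_cast h.1
    have := mul_nonneg hβ (peval_nonneg hβ h.2)
    simp only [peval_cons]; linarith

/-! ### Computed affine bounds for chains -/

/-- An affine bound for a chain: the coefficients `a / d`, `b / d` and the ends `lo / f`, `hi / f`
of its range are rational functions of `β`. -/
structure Response where
  a : List ℤ
  b : List ℤ
  d : List ℤ
  lo : List ℤ
  hi : List ℤ
  f : List ℤ
  ok : Bool

/-- Add a facility at the position of the last one. -/
def Response.same (r : Response) : Response where
  a := r.a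
  b := r.b
  d := padd r.d r.b
  lo := padd (pmul r.a r.f) (pmul (padd r.d r.b) r.lo)
  hi := padd (pmul r.a r.f) (pmul (padd r.d r.b) r.hi)
  f := pmul r.d r.f
  ok := r.ok

/-- Add a facility at distance `w`, where the boundary stays beyond the last facility. -/
def Response.far (r : Response) (w : ℤ) : Response where
  a := padd (psub r.a (psmul w (0 :: r.d))) (psmul w (padd r.b (psmul 2 (0 :: r.d))))
  b := padd r.b (psmul 2 (0 :: r.d))
  d := padd r.d (padd r.b (psmul 2 (0 :: r.d)))
  lo := pmul (psub (psub r.a (psmul w (0 :: r.d))) (psmul w r.d)) r.f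
  hi := padd (pmul (psub (psub r.a (psmul w (0 :: r.d))) (psmul w r.d)) r.f)
    (pmul (padd r.d (padd r.b (psmul 2 (0 :: r.d)))) r.hi)
  f := pmul r.d r.f
  ok := r.ok && decide (0 < w) && pnonneg (psmul (-1) r.lo)

/-- Add a facility at distance `2`, where the boundary is at distance at most `1` from the last
facility. -/
def Response.near (r : Response) (w : ℤ) : Response where
  a := padd (psub r.a (0 :: r.d)) (psmul 2 (padd r.b (0 :: r.d)))
  b := padd r.b (0 :: r.d)
  d := padd r.d (padd r.b (0 :: r.d))
  lo := psub (psub (psub r.a (0 :: r.d)) (psmul 2 r.d)) (padd r.d (padd r.b (0 :: r.d)))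
  hi := padd (psub (psub r.a (0 :: r.d)) (psmul 2 r.d)) (padd r.d (padd r.b (0 :: r.d)))
  f := r.d
  ok := r.ok && decide (w = 2) && pnonneg (psub (psmul (-1) r.f) r.lo) && pnonneg (psub r.hi r.f)

/-- An affine bound for a chain; for the last `c` gaps the second kind of estimate is used. -/
def response : List ℤ → ℕ → Response
  | [], _ => ⟨[], [], [], [], [], [], false⟩
  -- A single facility has load equal to its boundary, so the range is unrestricted; ±1000 is an
  -- arbitrary large choice.
  | [p], _ => ⟨[p], [1], [1], [-1000], [1000], [1], true⟩
  | p :: q :: l, c =>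
    if p = q then (response (q :: l) c).same
    else match c with
      | 0 => (response (q :: l) 0).far (p - q)
      | c + 1 => (response (q :: l) c).near (p - q)

/-- The response is a correct affine bound for the chain. -/
def Response.Valid (β : ℝ) (l : List ℤ) (r : Response) : Prop :=
  r.ok = true → 0 < peval β r.d ∧ 0 < peval β r.b ∧ 0 < peval β r.f ∧
    AffineBound β l (peval β r.a / peval β r.d) (peval β r.b / peval β r.d)
      (peval β r.lo / peval β r.f) (peval β r.hi / peval β r.f)

theorem Response.Valid.same {β : ℝ} (hβ : 0 ≤ β) {p : ℤ} {l : List ℤ} {r : Response}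
    (h : r.Valid β (p :: l)) : r.same.Valid β (p :: p :: l) := by
  intro hok
  obtain ⟨hd, hb, hf, hA⟩ := h hok
  simp only [Response.same, peval_padd, peval_pmul]
  generalize peval β r.a = a at *
  generalize peval β r.b = b at *
  generalize peval β r.d = d at *
  generalize peval β r.lo = lo at *
  generalize peval β r.hi = hi at *
  generalize peval β r.f = f at *
  have h1 : 0 < 1 + (b / d + 0 * β) := by have := div_pos hb hd; linarith
  refine ⟨by linarith, hb, by positivity, hA.cons hβ le_rfl (κ := 0) (μ := 0) h1 le_rfl le_rfl
    ?_ ?_ ?_ (le_of_eq ?_) (le_of_eq ?_)⟩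
  · intro δ _ _; simp
  all_goals field_simp
  all_goals ring

/-- For δ ≥ 0 the distance difference is at most 2δ - w, with equality as long as δ ≤ w. -/
theorem Response.Valid.far {β : ℝ} (hβ : 0 ≤ β) {p q : ℤ} {l : List ℤ} {r : Response}
    (h : r.Valid β (q :: l)) : (r.far (p - q)).Valid β (p :: q :: l) := by
  intro hok
  simp only [Response.far, Bool.and_eq_true, decide_eq_true_eq] at hok
  obtain ⟨⟨hok, hw⟩, hlo⟩ := hok
  obtain ⟨hd, hb, hf, hA⟩ := h hok
  have hlo := peval_nonneg hβ hlo
  simp only [Response.far, peval_padd, peval_pmul, peval_psub, peval_psmul, peval_cons] at hlo ⊢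
  have hw' : (0 : ℝ) < p - q := by exact_mod_cast hw
  push_cast at hlo ⊢
  generalize peval β r.a = a at *
  generalize peval β r.b = b at *
  generalize peval β r.d = d at *
  generalize peval β r.lo = lo at *
  generalize peval β r.hi = hi at *
  generalize peval β r.f = f at *
  have h1 : 0 < 1 + (b / d + 2 * β) := by positivity
  refine ⟨by positivity, by positivity, by positivity,
    hA.cons hβ (by omega) (κ := 2) (μ := p - q) h1
      (lo' := 0) (div_nonpos_of_nonpos_of_nonneg (by linarith) hf.le) le_rfl
      ?_ ?_ ?_ (le_of_eq ?_) (le_of_eq ?_)⟩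
  · intro δ hδ _
    rw [abs_of_nonneg hδ]
    linarith [le_abs_self ((p : ℝ) - q - δ)]
  all_goals field_simp
  all_goals ring

/-- The line δ - 1 is the chord of |δ| - |2 - δ| over [-1, 1]. Unlike the estimate 2δ - w, it also
covers boundaries before the facility at `q`. -/
theorem Response.Valid.near {β : ℝ} (hβ : 0 ≤ β) {p q : ℤ} {l : List ℤ} {r : Response}
    (h : r.Valid β (q :: l)) : (r.near (p - q)).Valid β (p :: q :: l) := by
  intro hok
  simp only [Response.near, Bool.and_eq_true, decide_eq_true_eq] at hok
  obtain ⟨⟨⟨hok, hw⟩, hlo⟩, hhi⟩ := hok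
  obtain ⟨hd, hb, hf, hA⟩ := h hok
  have hlo := peval_nonneg hβ hlo
  have hhi := peval_nonneg hβ hhi
  simp only [Response.near, peval_padd, peval_psub, peval_psmul, peval_cons] at hlo hhi ⊢
  have hw' : (p : ℝ) - q = 2 := by exact_mod_cast hw
  push_cast at hlo ⊢
  generalize peval β r.a = a at *
  generalize peval β r.b = b at *
  generalize peval β r.d = d at *
  generalize peval β r.lo = lo at *
  generalize peval β r.hi = hi at *
  generalize peval β r.f = f at *
  have h1 : 0 < 1 + (b / d + 1 * β) := by positivity
  refine ⟨by positivity, by positivity, hd,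
    hA.cons hβ (by omega) (κ := 1) (μ := 1) h1 (lo' := -1) (hi' := 1)
      (by rw [div_le_iff₀ hf]; linarith) (by rw [le_div_iff₀ hf]; linarith)
      ?_ ?_ ?_ (le_of_eq ?_) (le_of_eq ?_)⟩
  · intro δ h1 h2
    rw [hw', abs_of_nonneg (show 0 ≤ 2 - δ by linarith)]
    rcases abs_cases δ with h | h <;> linarith
  all_goals try rw [hw']
  all_goals field_simp
  all_goals ring

theorem response_valid {β : ℝ} (hβ : 0 ≤ β) (l : List ℤ) (c : ℕ) :
    (response l c).Valid β l := by
  induction l, c using response.induct with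
  | case1 => intro h; simp [response] at h
  | case2 p c =>
    intro _
    simpa [response] using affineBound_singleton β p (-1000) 1000
  | case3 c p l ih =>
    simp only [response, if_true]; exact ih.same hβ
  | case4 p q l hpq ih =>
    simp only [response, if_neg hpq]; exact ih.far hβ
  | case5 p q l hpq c ih =>
    simp only [response, if_neg hpq]; exact ih.near hβ

/-! ### The certificate for a facility between two chains -/

/-- The inequalities, at one of the two ends of the path of comparison boundaries, that bound the
load between two chains by `nb / db`: the right boundary is at distance `s / (db * e)` from the
right neighbor, and the location at distance `w - x / (db * e)` from it. -/
def endCheck (l r : Response) (w : ℤ) (nb db e s x : List ℤ) : Bool :=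
  let g := pmul db e
  let y := psub (psub (psmul w g) (pmul nb e)) s
  let q := padd (psub (psub (pmul (pmul nb l.d) e) (pmul l.a g)) (pmul l.b y))
    (0 :: pmul l.d x)
  pnonneg q && pnonneg (psub q (psmul 2 (0 :: pmul l.d y))) &&
    pnonneg (psub (pmul y l.f) (pmul l.lo g)) && pnonneg (psub (pmul l.hi g) (pmul y l.f)) &&
    pnonneg (psub (pmul r.hi g) (pmul s r.f))

/-- The certificate that a facility between two chains at distance `w` has load at most
`nb / db`. -/
def gapCheck (l r : Response) (w : ℤ) (nb db : List ℤ) : Bool :=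
  -- In the notation of `gap_load_le`, B - ar = t / (db * r.d), hence R₀ = s₀ / (db * e₀) and R₁ = t
  -- / (db * e₁). The last arguments of the two end checks encode ξ = 0 and ξ = w - R₁.
  let t := psub (pmul nb r.d) (pmul r.a db)
  let e₀ := padd r.b (psmul 2 (0 :: r.d))
  let s₀ := padd t (psmul w (0 :: pmul db r.d))
  let e₁ := padd r.b (0 :: r.d)
  l.ok && r.ok && pnonneg (psmul (-1) r.lo) && pnonneg t &&
    endCheck l r w nb db e₀ s₀ [] &&
    endCheck l r w nb db e₁ t (psub (psmul w (pmul db e₁)) t)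

/-- The certificate that a facility between the wall and a chain, whose first facility is at
distance `p` from the wall, has load at most `nb / db`. -/
def wallCheck (r : Response) (p : ℤ) (nb db : List ℤ) : Bool :=
  let t := psub nb (psmul p db)
  let y := psmul (-1) t
  r.ok && pnonneg t && pnonneg (psub (psub (pmul nb r.d) (pmul r.a db)) (pmul r.b y)) &&
    pnonneg (psub (pmul y r.f) (pmul r.lo db)) && pnonneg (psub (pmul r.hi db) (pmul y r.f))

theorem endCheck_sound {β : ℝ} (hβ : 0 ≤ β) {l r : Response} {w : ℤ} {nb db e s x : List ℤ}
    (h : endCheck l r w nb db e s x = true) (hdb : 0 < peval β db) (he : 0 < peval β e)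
    (hd : 0 < peval β l.d) (hf : 0 < peval β l.f) (hf' : 0 < peval β r.f) {B S X Y : ℝ}
    (hB : B = peval β nb / peval β db) (hS : S = peval β s / (peval β db * peval β e))
    (hX : X = peval β x / (peval β db * peval β e)) (hY : Y = w - B - S) :
    peval β l.a / peval β l.d + peval β l.b / peval β l.d * Y - β * X ≤ B ∧
    peval β l.a / peval β l.d + peval β l.b / peval β l.d * Y + β * (2 * Y - X) ≤ B ∧
    peval β l.lo / peval β l.f ≤ Y ∧ Y ≤ peval β l.hi / peval β l.f ∧
    S ≤ peval β r.hi / peval β r.f := by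
  simp only [endCheck, Bool.and_eq_true] at h
  obtain ⟨⟨⟨⟨h1, h2⟩, h3⟩, h4⟩, h5⟩ := h
  have h1 := peval_nonneg hβ h1
  have h2 := peval_nonneg hβ h2
  have h3 := peval_nonneg hβ h3
  have h4 := peval_nonneg hβ h4
  have h5 := peval_nonneg hβ h5
  simp only [peval_padd, peval_pmul, peval_psub, peval_psmul, peval_cons] at h1 h2 h3 h4 h5
  push_cast at h1 h2 h3 h4 h5
  generalize peval β l.a = a at *
  generalize peval β l.b = b at *
  generalize peval β l.d = d at *
  generalize peval β l.lo = lo at *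
  generalize peval β l.hi = hi at *
  generalize peval β l.f = f at *
  generalize peval β r.f = f' at *
  generalize peval β r.hi = hi' at *
  generalize peval β nb = n at *
  generalize peval β db = m at *
  generalize peval β e = e at *
  generalize peval β s = s at *
  generalize peval β x = x at *
  have hY' : Y = (w * (m * e) - n * e - s) / (m * e) := by
    rw [hY, hB, hS]; field_simp
  have hg : 0 < m * e := by positivity
  refine ⟨?_, ?_, ?_, ?_, ?_⟩
  · rw [← sub_nonneg, hY', hB, hX]
    refine (div_nonneg h1 (by positivity : 0 ≤ m * e * d)).trans_eq ?_
    field_simp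
    ring
  · rw [← sub_nonneg, hY', hB, hX]
    refine (div_nonneg h2 (by positivity : 0 ≤ m * e * d)).trans_eq ?_
    field_simp
    ring
  · rw [hY', div_le_div_iff₀ hf hg]; linarith
  · rw [hY', div_le_div_iff₀ hg hf]; linarith
  · rw [hS, div_le_div_iff₀ hg hf']; linarith

theorem gapCheck_sound {β : ℝ} (hβ : 0 ≤ β) {l r : Response} {w : ℤ} {nb db : List ℤ}
    (h : gapCheck l r w nb db = true) (hdb : 0 < peval β db) {p q : ℤ} {l' r' : List ℤ}
    (hl : l.Valid β (p :: l')) (hr : r.Valid β (q :: r')) {ξ δ ε m n : ℝ}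
    (hξ : 0 ≤ ξ) (hξw : ξ ≤ w) (hP : Chain β (p :: l') (p + δ) m)
    (hQ : Chain β (q :: r') (q + ε) n)
    (e₁ : w - δ - ε = m + β * (|δ| - |ξ - δ|))
    (e₂ : w - δ - ε = n + β * (|ε| - |w - ξ - ε|)) :
    w - δ - ε ≤ peval β nb / peval β db := by
  simp only [gapCheck, Bool.and_eq_true] at h
  obtain ⟨⟨⟨⟨⟨hlok, hrok⟩, hlo⟩, ht⟩, h0⟩, h1⟩ := h
  obtain ⟨hld, hlb, hlf, hlA⟩ := hl hlok
  obtain ⟨hrd, hrb, hrf, hrA⟩ := hr hrok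
  have hlo := peval_nonneg hβ hlo
  have ht := peval_nonneg hβ ht
  simp only [peval_pmul, peval_psub, peval_psmul] at hlo ht
  have hc0 := endCheck_sound hβ h0 hdb (by simp; positivity) hld hlf hrf rfl rfl rfl rfl
  have hc1 := endCheck_sound hβ h1 hdb (by simp; positivity) hld hlf hrf rfl rfl rfl rfl
  simp only [peval_padd, peval_pmul, peval_psub, peval_psmul, peval_cons, peval_nil] at hc0 hc1
  push_cast at hc0 hc1 hlo
  obtain ⟨c1, c2, c3, c4, c5⟩ := hc0
  obtain ⟨d1, d2, d3, d4, d5⟩ := hc1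
  rw [zero_div, mul_zero, sub_zero] at c1
  rw [zero_div, sub_zero] at c2
  refine gap_load_le hβ (P := fun δ m => Chain β (p :: l') (p + δ) m)
    (Q := fun δ m => Chain β (q :: r') (q + δ) m) (lor := peval β r.lo / peval β r.f)
    (ar := peval β r.a / peval β r.d) ?_ ?_ (div_pos hrb hrd)
    (div_nonpos_of_nonpos_of_nonneg (by linarith) hrf.le) ?_ ?_ ?_ c5 d5 c3 c4 d3 d4 c1 c2
    ?_ ?_ hξ hξw hP hQ e₁ e₂
  · intro δ h1 h2 δ' m hc hle
    exact hlA δ h1 h2 _ _ hc (by simpa using hle)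
  · intro δ h1 h2 δ' m hc hle
    exact hrA δ h1 h2 _ _ hc (by simpa using hle)
  · rw [div_le_div_iff₀ hrd hdb]; linarith
  · field_simp; ring
  · field_simp; ring
  · refine le_trans (le_of_eq ?_) d1
    congr 2
    field_simp
  · refine le_trans (le_of_eq ?_) d2
    congr 3
    field_simp

theorem wallCheck_sound {β : ℝ} (hβ : 0 ≤ β) {r : Response} {p : ℤ} {nb db : List ℤ}
    (h : wallCheck r p nb db = true) (hdb : 0 < peval β db) {q : ℤ} {r' : List ℤ}
    (hr : r.Valid β (q :: r')) {x y n : ℝ} (hx : x ≤ p)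
    (hQ : Chain β (q :: r') (q + (p - y)) n) (e : y = n + β * (|p - y| - |x - y|)) :
    y ≤ peval β nb / peval β db := by
  simp only [wallCheck, Bool.and_eq_true] at h
  obtain ⟨⟨⟨⟨hok, h1⟩, h2⟩, h3⟩, h4⟩ := h
  obtain ⟨hd, hb, hf, hA⟩ := hr hok
  have h1 := peval_nonneg hβ h1
  have h2 := peval_nonneg hβ h2
  have h3 := peval_nonneg hβ h3
  have h4 := peval_nonneg hβ h4
  simp only [peval_pmul, peval_psub, peval_psmul] at h1 h2 h3 h4
  push_cast at h2 h3 h4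
  have hs : (p : ℝ) - peval β nb / peval β db = -(peval β nb - p * peval β db) / peval β db := by
    field_simp; ring
  refine wall_load_le hβ (Q := fun δ m => Chain β (q :: r') (q + δ) m)
    (fun δ h1 h2 δ' m hc hle => hA δ h1 h2 _ _ hc (by simpa using hle))
    ?_ ?_ ?_ ?_ hx hQ e
  · rw [le_div_iff₀ hdb]; linarith
  · rw [hs, div_le_div_iff₀ hf hdb]; linarith
  · rw [hs, div_le_div_iff₀ hdb hf]; linarith
  · rw [hs, ← sub_nonneg]
    refine (div_nonneg h2 (by positivity : 0 ≤ peval β db * peval β r.d)).trans_eq ?_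
    field_simp
    ring

/-! ### The certificate for the Eaton–Lipsey placements -/

/-- The list `p (m - 1), …, p 0`. -/
def stack (p : ℕ → ℤ) : ℕ → List ℤ
  | 0 => []
  | m + 1 => p m :: stack p m

/-- The location of facility `j`, in multiples of `1 / (2k)`. -/
def pairPos (n j : ℕ) : ℤ := 2 * ((pairIndex n j / 2 : ℕ) : ℤ) + 1

/-- The map from `{0, …, n - 2}` to the facilities other than `i`. -/
def skip (i j : ℕ) : ℕ := if j < i then j else j + 1

/-- Numerators of the loads of the Eaton–Lipsey placement as polynomials in `β = (1 - α) / α`. -/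
def loadNum (n j : ℕ) : List ℤ :=
  match n with
  | 5 => if j = 2 then [6, 8] else [6, 4]
  | 7 => if j < 2 then [8, 68, 128, 64] else if j < 4 then [8, 72, 144, 64]
      else if j = 4 then [8, 80, 192, 128] else [8, 76, 144, 64]
  | 9 => if j < 2 ∨ 6 < j then [10, 28, 16] else if j = 4 then [10, 40, 32] else [10, 32, 16]
  | _ => [1]

/-- The common denominator of the loads. -/
def loadDen (n : ℕ) : List ℤ :=
  match n with
  | 5 => [5, 4]
  | 7 => [7, 64, 128, 64]
  | 9 => [9, 28, 16]
  | _ => [1]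

/-- The numerator of `rho n` as a polynomial in `β = (1 - α) / α`. -/
def rhoNum (n : ℕ) : List ℤ :=
  match n with
  | 4 => [4, 9, 4]
  | 5 => [15, 87, 135, 80, 16]
  | 6 => [6, 33, 44, 16]
  | 7 => [28, 501, 3284, 10020, 15920, 13568, 5888, 1024]
  | 8 => [8, 81, 216, 208, 64]
  | 9 => [45, 725, 3250, 6320, 6048, 2816, 512]
  | 10 => [10, 161, 712, 1264, 960, 256]
  | _ => [1]

/-- The denominator of `rho n` as a polynomial in `β = (1 - α) / α`. -/
def rhoDen (n : ℕ) : List ℤ :=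
  match n with
  | 4 => [4, 8, 4]
  | 5 => [15, 79, 124, 76, 16]
  | 6 => [6, 30, 40, 16]
  | 7 => [28, 482, 3058, 9132, 14464, 12544, 5632, 1024]
  | 8 => [8, 76, 196, 192, 64]
  | 9 => [45, 691, 2974, 5720, 5568, 2688, 512]
  | 10 => [10, 154, 656, 1152, 896, 256]
  | _ => [1]

/-- The certificate that a facility has load at most `nb / db` if the chains on its left and right
are `l` and `r`, the total length being `K`. -/
def sideCheck (K : ℤ) (nb db : List ℤ) : List ℤ → List ℤ → Bool
  | [], [] => false
  | [], q :: r => [0, 1, 2].any fun c => wallCheck (response (q :: r) c) (K - q) nb db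
  | p :: l, [] => [0, 1, 2].any fun c => wallCheck (response (p :: l) c) (K - p) nb db
  | p :: l, q :: r =>
    -- Between co-located neighbors there is no room: the mover lies strictly to the right of the
    -- left neighbor and not beyond the right one.
    decide (K - q - p ≤ 0) || [0, 1, 2].any fun c =>
      gapCheck (response (p :: l) c) (response (q :: r) 0) (K - q - p) nb db ||
        gapCheck (response (q :: r) c) (response (p :: l) 0) (K - q - p) nb db

/-- The certificate for facility `i` of `n` moving to a place with `m` other facilities on her
left. -/
def moveCheck (n i m : ℕ) : Bool :=
  sideCheck (2 * numPairs n : ℕ) (pmul (rhoNum n) (loadNum n i)) (pmul (rhoDen n) (loadDen n))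
    (stack (fun j => pairPos n (skip i j)) m)
    (stack (fun j => (2 * numPairs n : ℕ) - pairPos n (skip i (n - 2 - j))) (n - 1 - m))

theorem moveCheck_all :
    ([4, 5, 6, 7, 8, 9, 10].all fun n => (List.range n).all fun i =>
      decide (i ≠ 0 ∧ pairPos n (i - 1) = pairPos n i) ||
        (List.range n).all fun m => moveCheck n i m) = true := by
  decide +kernel

theorem loadNum_partner :
    ([4, 5, 6, 7, 8, 9, 10].all fun n => (List.range n).all fun i =>
      decide (pairPos n (i - 1) = pairPos n i → loadNum n (i - 1) = loadNum n i)) = true := by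
  decide +kernel

/-- Removing either member of a pair leaves the same locations, so `moveCheck_all` only evaluates
the first one. -/
theorem pairPos_skip_partner {n i : ℕ} (_ : i ≠ 0) (h : pairPos n (i - 1) = pairPos n i) (j : ℕ) :
    pairPos n (skip (i - 1) j) = pairPos n (skip i j) := by
  unfold skip
  by_cases h1 : j < i - 1
  · rw [if_pos h1, if_pos (by omega)]
  · by_cases h2 : j < i
    · rw [if_neg h1, if_pos h2, show j = i - 1 by omega, show i - 1 + 1 = i by omega, h]
    · rw [if_neg h1, if_neg h2]

theorem moveCheck_eq_true {n i m : ℕ} (hn4 : 4 ≤ n) (hn10 : n ≤ 10) (hi : i < n) (hm : m < n) :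
    moveCheck n i m = true := by
  have hn : n ∈ [4, 5, 6, 7, 8, 9, 10] := by
    simp only [List.mem_cons, List.not_mem_nil]; omega
  have main : ∀ i < n, ¬ (i ≠ 0 ∧ pairPos n (i - 1) = pairPos n i) → moveCheck n i m = true := by
    intro i hi h
    have := List.all_eq_true.1 (List.all_eq_true.1 moveCheck_all n hn) i (List.mem_range.2 hi)
    rw [decide_eq_false h, Bool.false_or] at this
    exact List.all_eq_true.1 this m (List.mem_range.2 hm)
  induction i with
  | zero => exact main 0 hi (by simp)
  | succ i ih =>
    by_cases h : pairPos n i = pairPos n (i + 1)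
    · have hl := of_decide_eq_true (List.all_eq_true.1 (List.all_eq_true.1 loadNum_partner n hn)
        (i + 1) (List.mem_range.2 hi)) h
      have := ih (by omega)
      unfold moveCheck at this ⊢
      simp only [← pairPos_skip_partner (Nat.succ_ne_zero i) h, ← hl]
      exact this
    · exact main _ hi (fun h' => h h'.2)

/-- All clients at the interior breakpoints `x 1, …, x (n - 1)` are indifferent, where facility `j`
at `s j` serves the clients between `x j` and `x (j + 1)`. -/
def Balanced (β : ℝ) (n : ℕ) (s x : ℕ → ℝ) : Prop :=
  ∀ j, j + 1 < n → x (j + 2) - x (j + 1) =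
    x (j + 1) - x j + β * (|s j - x (j + 1)| - |s (j + 1) - x (j + 1)|)

theorem chain_stack {β : ℝ} {p : ℕ → ℤ} {x : ℕ → ℝ} (h0 : x 0 = 0) {m : ℕ}
    (h : Balanced β (m + 1) (fun j => (p j : ℝ)) x) :
    Chain β (stack p (m + 1)) (x (m + 1)) (x (m + 1) - x m) := by
  induction m with
  | zero => simp [stack, Chain, h0]
  | succ m ih =>
    refine ⟨x (m + 1) - x m, ?_, ?_⟩
    · have := ih (fun j hj => h j (by omega))
      simpa [stack] using this
    · have := h m (by omega)
      simpa using this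

/-- Reflection turns the facilities on the right of the mover into a chain starting at a wall at 0.
-/
theorem Balanced.reverse {β : ℝ} {n : ℕ} {s x : ℕ → ℝ} (h : Balanced β n s x) (K : ℝ) :
    Balanced β n (fun j => K - s (n - 1 - j)) (fun j => K - x (n - j)) := by
  intro j hj
  have := h (n - 2 - j) (by omega)
  rw [show n - 2 - j + 2 = n - j by omega, show n - 2 - j + 1 = n - (j + 1) by omega] at this
  simp only [show n - 1 - j = n - (j + 1) by omega, show n - 1 - (j + 1) = n - 2 - j by omega,
    show n - (j + 2) = n - 2 - j by omega]
  have e : ∀ a b : ℝ, |K - a - (K - b)| = |a - b| := fun a b => by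
    rw [abs_sub_comm a b]; congr 1; ring
  rw [e, e]
  linarith

/-- The sequence of positions `p 0, …, p (m - 1), x, p m, …`. -/
def insertPos (p : ℕ → ℤ) (m : ℕ) (x : ℝ) (j : ℕ) : ℝ :=
  if j < m then p j else if j = m then x else p (j - 1)

theorem sideCheck_sound {β : ℝ} (hβ : 0 ≤ β) {N m : ℕ} (hm : m ≤ N) {K : ℤ} {nb db : List ℤ}
    {p : ℕ → ℤ}
    (h : sideCheck K nb db (stack p m) (stack (fun j => K - p (N - 1 - j)) (N - m)) = true)
    (hdb : 0 < peval β db) {X : ℕ → ℝ} {x : ℝ} (h0 : X 0 = 0) (hK : X (N + 1) = K)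
    (hX : Balanced β (N + 1) (insertPos p m x) X)
    (hl : 0 < m → (p (m - 1) : ℝ) < x) (hr : m < N → x ≤ p m) :
    X (m + 1) - X m ≤ peval β nb / peval β db := by
  -- the chain on the left
  have hleft : ∀ a, m = a + 1 → Chain β (stack p (a + 1)) (X (a + 1)) (X (a + 1) - X a) := by
    intro a ha
    refine chain_stack h0 fun j hj => ?_
    have := hX j (by omega)
    simpa only [insertPos, if_pos (show j < m by omega), if_pos (show j + 1 < m by omega)]
      using this
  -- the chain on the right
  have hright : ∀ b, N = m + (b + 1) → Chain β (stack (fun j => K - p (N - 1 - j)) (b + 1))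
      (K - X (m + 1)) (X (m + 2) - X (m + 1)) := by
    intro b hb
    have hrev := hX.reverse K
    have := chain_stack (β := β) (p := fun j => K - p (N - 1 - j))
      (x := fun j => K - X (N + 1 - j)) (by simp [hK]) (m := b) (fun j hj => by
        have := hrev j (by omega)
        simp only [insertPos, if_neg (show ¬ N + 1 - 1 - j < m by omega),
          if_neg (show ¬ N + 1 - 1 - j = m by omega),
          if_neg (show ¬ N + 1 - 1 - (j + 1) < m by omega),
          if_neg (show ¬ N + 1 - 1 - (j + 1) = m by omega)] at this
        push_cast
        simpa only [show N + 1 - 1 - j - 1 = N - 1 - j by omega,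
          show N + 1 - 1 - (j + 1) - 1 = N - 1 - (j + 1) by omega, show N + 1 - (j + 1) = N - j by omega,
          show N + 1 - (j + 2) = N - (j + 1) by omega] using this)
    simp only [show N + 1 - (b + 1) = m + 1 by omega, show N + 1 - b = m + 2 by omega] at this
    convert this using 1
    ring
  rcases Nat.eq_zero_or_pos m with rfl | hmpos
  · rcases Nat.eq_zero_or_pos N with rfl | hN
    · simp [stack, sideCheck] at h
    · obtain ⟨b, rfl⟩ : ∃ b, N = b + 1 := ⟨N - 1, by omega⟩
      have hc := hright b (by omega)
      have e := hX 0 (by omega)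
      simp only [Nat.sub_zero, stack, sideCheck, List.any_eq_true] at h hc
      obtain ⟨c, -, h⟩ := h
      have hp : (K : ℤ) - (K - p (b + 1 - 1 - b)) = p 0 := by
        rw [show b + 1 - 1 - b = 0 by omega]; ring
      rw [hp] at h
      have := wallCheck_sound hβ h hdb (response_valid hβ _ c) (x := x) (y := X 1)
        (n := X 2 - X 1) (by simpa using hr (by omega)) (by
          convert hc using 2
          rw [show b + 1 - 1 - b = 0 by omega]; push_cast; ring) (by
          simp [insertPos, h0] at e
          linarith)
      simpa [h0] using this
  · obtain ⟨a, rfl⟩ : ∃ a, m = a + 1 := ⟨m - 1, by omega⟩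
    have hcl := hleft a rfl
    have el := hX a (by omega)
    simp only [insertPos, if_pos (Nat.lt_succ_self a), lt_irrefl, if_true, if_false] at el
    have hl := hl (Nat.succ_pos a)
    simp only [Nat.add_sub_cancel] at hl
    rcases hm.eq_or_lt with hN | hN
    · simp only [hN, Nat.sub_self, stack] at h
      subst hN
      simp only [sideCheck, stack, List.any_eq_true] at h hcl
      obtain ⟨c, -, h⟩ := h
      have := wallCheck_sound hβ h hdb (response_valid hβ _ c) (x := K - x)
        (y := X (a + 2) - X (a + 1)) (n := X (a + 1) - X a) (by push_cast; linarith) (by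
          convert hcl using 1
          rw [hK]; push_cast; ring) (by
          rw [hK] at el ⊢
          rw [el]
          have e1 : ((K - p a : ℤ) : ℝ) - (X (a + 1) - X a + β * (|(p a : ℝ) - X (a + 1)| -
            |x - X (a + 1)|)) = X (a + 1) - p a := by rw [← el]; push_cast; ring
          have e2 : (K : ℝ) - x - (X (a + 1) - X a + β * (|(p a : ℝ) - X (a + 1)| -
            |x - X (a + 1)|)) = X (a + 1) - x := by rw [← el]; ring
          rw [e1, e2, abs_sub_comm (X (a + 1)), abs_sub_comm (X (a + 1))])
      simpa using this
    · obtain ⟨b, rfl⟩ : ∃ b, N = a + 1 + (b + 1) := ⟨N - (a + 2), by omega⟩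
      have hcr := hright b rfl
      have er := hX (a + 1) (by omega)
      have hr := hr (by omega)
      simp only [insertPos, lt_irrefl, if_true, if_false, if_neg (show ¬ a + 1 + 1 < a + 1 by omega),
        if_neg (show ¬ a + 1 + 1 = a + 1 by omega), Nat.add_sub_cancel] at er
      simp only [Nat.add_sub_cancel_left, stack, sideCheck, Bool.or_eq_true, decide_eq_true_eq,
        List.any_eq_true] at h hcl hcr
      have hp : a + 1 + (b + 1) - 1 - b = a + 1 := by omega
      rw [hp] at h hcr
      have hw : (K - (K - p (a + 1)) - p a : ℤ) = p (a + 1) - p a := by ring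
      rw [hw] at h
      rcases h with h | ⟨c, -, h | h⟩
      · have : (p (a + 1) : ℝ) - p a ≤ 0 := by exact_mod_cast h
        linarith
      · have := gapCheck_sound hβ h hdb (response_valid hβ _ c) (response_valid hβ _ 0)
          (ξ := x - p a) (δ := X (a + 1) - p a) (ε := p (a + 1) - X (a + 2))
          (m := X (a + 1) - X a) (n := X (a + 3) - X (a + 2)) (by linarith)
          (by push_cast; linarith) (by convert hcl using 1; ring)
          (by convert hcr using 1; push_cast; ring)
          (by
            push_cast
            rw [show x - p a - (X (a + 1) - p a) = x - X (a + 1) by ring,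
              abs_sub_comm (X (a + 1)) (p a : ℝ)]
            linarith)
          (by
            push_cast
            rw [show (p (a + 1) : ℝ) - p a - (x - p a) - (p (a + 1) - X (a + 2)) =
              X (a + 2) - x by ring, abs_sub_comm (X (a + 2)) x]
            linarith)
        refine le_trans (le_of_eq ?_) this
        push_cast; ring
      -- The mirrored certificate: the right chain takes the role of the left one.
      · have := gapCheck_sound hβ h hdb (response_valid hβ _ c) (response_valid hβ _ 0)
          (ξ := p (a + 1) - x) (ε := X (a + 1) - p a) (δ := p (a + 1) - X (a + 2))
          (n := X (a + 1) - X a) (m := X (a + 3) - X (a + 2)) (by linarith)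
          (by push_cast; linarith) (by convert hcr using 1; push_cast; ring)
          (by convert hcl using 1; ring)
          (by
            push_cast
            rw [show (p (a + 1) : ℝ) - x - (p (a + 1) - X (a + 2)) =
              X (a + 2) - x by ring, abs_sub_comm (X (a + 2)) x]
            linarith)
          (by
            push_cast
            rw [show (p (a + 1) : ℝ) - p a - (p (a + 1) - x) - (X (a + 1) - p a) =
              x - X (a + 1) by ring, abs_sub_comm (X (a + 1)) (p a : ℝ)]
            linarith)
        refine le_trans (le_of_eq ?_) this
        push_cast; ring

/-! ### Breakpoints in equilibrium -/

/-- The shooting sequence: consecutive breakpoints such that the first load is `a` and all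
clients at the breakpoints are indifferent. -/
noncomputable def shoot (β : ℝ) (s : ℕ → ℝ) (a : ℝ) : ℕ → ℝ × ℝ
  | 0 => (0, a)
  | j + 1 =>
    ((shoot β s a j).2, (shoot β s a j).2 + ((shoot β s a j).2 - (shoot β s a j).1) +
      β * (|s j - (shoot β s a j).2| - |s (j + 1) - (shoot β s a j).2|))

theorem continuous_shoot (β : ℝ) (s : ℕ → ℝ) (j : ℕ) : Continuous fun a => shoot β s a j := by
  induction j with
  | zero => simp only [shoot]; fun_prop
  | succ j ih => simp only [shoot]; fun_prop

/-- Raising the first load moves every later breakpoint by at least as much, because the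
indifference terms are monotone. With slope at least 1, the last breakpoint takes every real value;
negative loads are allowed here and excluded in `Balanced.lt`. -/
theorem shoot_mono {β : ℝ} (hβ : 0 ≤ β) {s : ℕ → ℝ} (hs : Monotone s) {a b : ℝ} (hab : a ≤ b)
    (j : ℕ) : 0 ≤ (shoot β s b j).1 - (shoot β s a j).1 ∧
      (shoot β s b j).1 - (shoot β s a j).1 + (b - a) ≤
        (shoot β s b j).2 - (shoot β s a j).2 := by
  induction j with
  | zero => simp [shoot]
  | succ j ih =>
    have h := abs_sub_abs_mono (hs (Nat.le_succ j))
      (show (shoot β s a j).2 ≤ (shoot β s b j).2 by linarith)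
    have h := mul_le_mul_of_nonneg_left h hβ
    simp only [shoot]
    constructor <;> linarith

theorem exists_balanced {β : ℝ} (hβ : 0 ≤ β) {s : ℕ → ℝ} (hs : Monotone s) {n : ℕ} (hn : 0 < n) :
    ∃ x : ℕ → ℝ, x 0 = 0 ∧ x n = 1 ∧ Balanced β n s x := by
  obtain ⟨m, rfl⟩ : ∃ m, n = m + 1 := ⟨n - 1, by omega⟩
  have hc : Continuous fun a => (shoot β s a m).2 := (continuous_shoot β s m).snd
  have hle : ∃ a, (shoot β s a m).2 ≤ 1 := by
    refine ⟨-|(shoot β s 0 m).2|, ?_⟩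
    have := shoot_mono hβ hs (neg_nonpos.2 (abs_nonneg (shoot β s 0 m).2)) m
    linarith [le_abs_self (shoot β s 0 m).2]
  have hge : ∃ a, 1 ≤ (shoot β s a m).2 := by
    refine ⟨|(shoot β s 0 m).2| + 1, ?_⟩
    have := shoot_mono hβ hs (show 0 ≤ |(shoot β s 0 m).2| + 1 by positivity) m
    linarith [neg_abs_le (shoot β s 0 m).2]
  obtain ⟨a, ha⟩ := mem_range_of_exists_le_of_exists_ge hc hle hge
  refine ⟨fun j => (shoot β s a j).1, by simp [shoot], by simpa [shoot] using ha, ?_⟩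
  intro j _
  simp only [shoot]
  ring

/-- At the first nonpositive load the right breakpoint is at most the facility's location and below
1. From there on the breakpoints stay to the left of the locations, so the loads stay nonpositive
and the breakpoint 1 is never reached. -/
theorem Balanced.lt {β : ℝ} {n : ℕ} {s x : ℕ → ℝ} (h : Balanced β n s x) (hβ : 0 ≤ β)
    (hs : Monotone s) (hs0 : ∀ j, 0 ≤ s j) (hs1 : ∀ j, s j ≤ 1) (h0 : x 0 = 0) (h1 : x n = 1) :
    ∀ j < n, x j < x (j + 1) := by
  by_contra! hcon
  classical
  set i := Nat.find hcon with hi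
  obtain ⟨hin, hile⟩ := Nat.find_spec hcon
  rw [← hi] at hin hile
  have hbase : x (i + 1) ≤ s i ∧ x (i + 1) < 1 := by
    rcases Nat.eq_zero_or_pos i with h' | h'
    · rw [h', h0] at hile
      rw [h']
      exact ⟨hile.trans (hs0 0), by linarith⟩
    · have hmin := Nat.find_min hcon (show i - 1 < Nat.find hcon by omega)
      push Not at hmin
      have hlt := hmin (by omega)
      have hb := h (i - 1) (by omega)
      rw [show i - 1 + 2 = i + 1 by omega, show i - 1 + 1 = i by omega] at hb
      rw [show i - 1 + 1 = i by omega] at hlt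
      have hxi : x i < s i := by
        by_contra! hc
        have hm : s (i - 1) ≤ s i := hs (by omega)
        rw [abs_of_nonpos (by linarith), abs_of_nonpos (by linarith)] at hb
        nlinarith
      have := hs1 i
      constructor <;> linarith
  have hall : ∀ j, i ≤ j → j < n → x (j + 1) ≤ x j ∧ x (j + 1) ≤ s j ∧ x (j + 1) < 1 := by
    intro j hij
    induction j, hij using Nat.le_induction with
    | base => intro _; exact ⟨hile, hbase⟩
    | succ j hij ih =>
      intro hj
      obtain ⟨h2, h3, h4⟩ := ih (by omega)
      have hb := h j hj
      have hm : s j ≤ s (j + 1) := hs (Nat.le_succ j)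
      rw [abs_of_nonneg (by linarith), abs_of_nonneg (by linarith)] at hb
      have : x (j + 1 + 1) - x (j + 1) ≤ 0 := by
        rw [show j + 1 + 1 = j + 2 from rfl]; nlinarith
      exact ⟨by linarith, by linarith, by linarith⟩
  have := (hall (n - 1) (by omega) (by omega)).2.2
  rw [show n - 1 + 1 = n by omega] at this
  linarith

/-- The cost comparison is chained over consecutive facilities between `i` and `k`: equality at each
common breakpoint extends to clients on the nearer side by `abs_sub_abs_mono`. -/
theorem Balanced.cost_le {β : ℝ} {n : ℕ} {s x : ℕ → ℝ} (h : Balanced β n s x) (hβ : 0 ≤ β)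
    (hs : Monotone s) (hlt : ∀ j < n, x j < x (j + 1)) {i k : ℕ} (hi : i < n) (hk : k < n)
    {z : ℝ} (hz : x i ≤ z) (hz' : z ≤ x (i + 1)) :
    β * |s i - z| + (x (i + 1) - x i) ≤ β * |s k - z| + (x (k + 1) - x k) := by
  rcases le_total i k with hik | hik
  · have : x (i + 1) ≤ x (k + 1) ∧
        β * |s i - z| + (x (i + 1) - x i) ≤ β * |s k - z| + (x (k + 1) - x k) := by
      induction k, hik using Nat.le_induction with
      | base => exact ⟨le_rfl, le_rfl⟩
      | succ k hik ih =>
        obtain ⟨h1, h2⟩ := ih (by omega)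
        have hb := h k hk
        have hm := mul_le_mul_of_nonneg_left
          (abs_sub_abs_mono (hs (Nat.le_succ k)) (hz'.trans h1)) hβ
        exact ⟨h1.trans (hlt _ hk).le, by rw [show k + 1 + 1 = k + 2 from rfl]; linarith⟩
    exact this.2
  · have : x k ≤ x i ∧
        β * |s i - z| + (x (i + 1) - x i) ≤ β * |s k - z| + (x (k + 1) - x k) := by
      revert hk
      induction hik using Nat.decreasingInduction with
      | self => intro _; exact ⟨le_rfl, le_rfl⟩
      | of_succ k hk' ih =>
        intro hk
        obtain ⟨h1, h2⟩ := ih (by omega)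
        have hb := h k (by omega)
        have hm := mul_le_mul_of_nonneg_left
          (abs_sub_abs_mono (hs (Nat.le_succ k)) (h1.trans hz)) hβ
        exact ⟨(hlt _ hk).le.trans h1, by rw [show k + 1 + 1 = k + 2 from rfl] at h2; linarith⟩
    exact this.2

/-- Breakpoints of a client equilibrium for the sorted locations `s 0 ≤ … ≤ s (n - 1)`, with equal
loads for co-located facilities. -/
structure IsSolution (α : ℝ) (n : ℕ) (s x : ℕ → ℝ) : Prop where
  zero : x 0 = 0
  one : x n = 1
  lt : ∀ j < n, x j < x (j + 1)
  cost_le : ∀ i < n, ∀ k < n, ∀ z, x i ≤ z → z ≤ x (i + 1) →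
    (1 - α) * |s i - z| + α * (x (i + 1) - x i) ≤ (1 - α) * |s k - z| + α * (x (k + 1) - x k)
  ties : ∀ i < n, ∀ k < n, s i = s k → x (i + 1) - x i = x (k + 1) - x k

theorem Balanced.isSolution {α : ℝ} (hα : 0 < α) (hα1 : α ≤ 1) {n : ℕ} {s x : ℕ → ℝ}
    (h : Balanced ((1 - α) / α) n s x) (hs : Monotone s) (hs0 : ∀ j, 0 ≤ s j)
    (hs1 : ∀ j, s j ≤ 1) (h0 : x 0 = 0) (h1 : x n = 1) : IsSolution α n s x := by
  have hβ : 0 ≤ (1 - α) / α := div_nonneg (by linarith) hα.le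
  have hlt := h.lt hβ hs hs0 hs1 h0 h1
  refine ⟨h0, h1, hlt, ?_, ?_⟩
  · intro i hi k hk z hz hz'
    have := mul_le_mul_of_nonneg_left (h.cost_le hβ hs hlt hi hk hz hz') hα.le
    have e : α * ((1 - α) / α) = 1 - α := by field_simp
    rw [mul_add, mul_add, ← mul_assoc, ← mul_assoc, e] at this
    exact this
  · intro i hi k hk e
    have h1 := h.cost_le hβ hs hlt hi hk le_rfl (hlt i hi).le
    have h2 := h.cost_le hβ hs hlt hk hi le_rfl (hlt k hk).le
    rw [e] at h1 h2
    linarith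

theorem IsSolution.mono {α : ℝ} {n : ℕ} {s x : ℕ → ℝ} (h : IsSolution α n s x) {i j : ℕ}
    (hij : i ≤ j) (hj : j ≤ n) : x i ≤ x j := by
  induction j, hij using Nat.le_induction with
  | base => rfl
  | succ j hij ih => exact (ih (by omega)).trans (h.lt j (by omega)).le

theorem IsSolution.mem_Icc {α : ℝ} {n : ℕ} {s x : ℕ → ℝ} (h : IsSolution α n s x) {j : ℕ}
    (hj : j ≤ n) : x j ∈ Set.Icc (0 : ℝ) 1 :=
  ⟨h.zero ▸ h.mono (Nat.zero_le j) hj, h.one ▸ h.mono hj le_rfl⟩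

theorem exists_le_lt_succ {n : ℕ} {x : ℕ → ℝ} {z : ℝ} (h0 : x 0 ≤ z) (h1 : z < x n) :
    ∃ i < n, x i ≤ z ∧ z < x (i + 1) := by
  induction n with
  | zero => linarith
  | succ n ih =>
    rcases lt_or_ge z (x n) with h | h
    · obtain ⟨i, hi, h⟩ := ih h; exact ⟨i, by omega, h⟩
    · exact ⟨n, by omega, h, h1⟩

theorem exists_lt_le_succ {n : ℕ} {x : ℕ → ℝ} {z : ℝ} (h0 : x 0 < z) (h1 : z ≤ x n) :
    ∃ i < n, x i < z ∧ z ≤ x (i + 1) := by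
  induction n with
  | zero => linarith
  | succ n ih =>
    rcases le_or_gt z (x n) with h | h
    · obtain ⟨i, hi, h⟩ := ih h; exact ⟨i, by omega, h⟩
    · exact ⟨n, by omega, h, h1⟩

-- Cost inequalities and ties pass to the limit; the point is that no interval degenerates, which is
-- derived from the tie condition.
open Filter Topology in
theorem isSolution_zero_of_tendsto {U : Filter ℝ} [U.NeBot] (hU : U ≤ 𝓝 0) {n : ℕ} {s : ℕ → ℝ}
    (hs0 : ∀ j, 0 ≤ s j) (hs1 : ∀ j, s j ≤ 1) {X : ℝ → ℕ → ℝ} {x : ℕ → ℝ}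
    (hX : ∀ᶠ α in U, IsSolution α n s (X α))
    (hx : ∀ j ≤ n, Tendsto (fun α => X α j) U (𝓝 (x j))) : IsSolution 0 n s x := by
  have hα : Tendsto (fun α : ℝ => α) U (𝓝 0) := hU
  have h0 : x 0 = 0 := tendsto_nhds_unique (hx 0 (Nat.zero_le n))
    (tendsto_const_nhds.congr' (hX.mono fun α h => h.zero.symm))
  have h1 : x n = 1 := tendsto_nhds_unique (hx n le_rfl)
    (tendsto_const_nhds.congr' (hX.mono fun α h => h.one.symm))
  have hload : ∀ j < n, Tendsto (fun α => X α (j + 1) - X α j) U (𝓝 (x (j + 1) - x j)) :=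
    fun j hj => (hx (j + 1) hj).sub (hx j hj.le)
  have hle : ∀ j < n, x j ≤ x (j + 1) := fun j hj =>
    le_of_tendsto_of_tendsto (hx j hj.le) (hx (j + 1) hj) (hX.mono fun α h => (h.lt j hj).le)
  have ties : ∀ i < n, ∀ k < n, s i = s k → x (i + 1) - x i = x (k + 1) - x k :=
    fun i hi k hk e => tendsto_nhds_unique (hload i hi)
      ((hload k hk).congr' (hX.mono fun α h => (h.ties i hi k hk e).symm))
  -- the inequality between costs, for intervals of positive length
  have cost : ∀ i < n, ∀ k < n, x i < x (i + 1) → ∀ z, x i ≤ z → z ≤ x (i + 1) →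
      |s i - z| ≤ |s k - z| := by
    intro i hi k hk hlt z hz hz'
    have hopen : ∀ z ∈ Set.Ioo (x i) (x (i + 1)), |s i - z| ≤ |s k - z| := by
      intro z hz
      have hev : ∀ᶠ α in U, (1 - α) * |s i - z| + α * (X α (i + 1) - X α i) ≤
          (1 - α) * |s k - z| + α * (X α (k + 1) - X α k) := by
        filter_upwards [hX, (hx i hi.le).eventually_lt_const hz.1,
          (hx (i + 1) hi).eventually_const_lt hz.2] with α h h1 h2
        exact h.cost_le i hi k hk z h1.le h2.le
      have hlim : ∀ j < n, Tendsto (fun α => (1 - α) * |s j - z| + α * (X α (j + 1) - X α j)) U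
          (𝓝 ((1 - 0) * |s j - z| + 0 * (x (j + 1) - x j))) := fun j hj =>
        ((tendsto_const_nhds.sub hα).mul tendsto_const_nhds).add (hα.mul (hload j hj))
      have := le_of_tendsto_of_tendsto (hlim i hi) (hlim k hk) hev
      simpa using this
    have hcl : IsClosed {z : ℝ | |s i - z| ≤ |s k - z|} :=
      isClosed_le (by fun_prop) (by fun_prop)
    have := hcl.closure_subset_iff.2 (fun z hz => hopen z hz)
    rw [closure_Ioo hlt.ne] at this
    exact this ⟨hz, hz'⟩
  -- The location of a facility with empty limit interval lies in an interval of positive length.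
  -- The owner of that interval must be at distance 0 from it, hence co-located, and ties would make
  -- the two loads equal.
  have lt : ∀ j < n, x j < x (j + 1) := by
    intro j hj
    by_contra! hcon
    have hj0 : x (j + 1) - x j = 0 := by linarith [hle j hj]
    have key : ∀ i < n, x i < x (i + 1) → x i ≤ s j → s j ≤ x (i + 1) → False := by
      intro i hi hlt ha hb
      have := cost i hi j hj hlt (s j) ha hb
      rw [sub_self, abs_zero] at this
      have e : s i = s j := by
        have := abs_eq_zero.1 (le_antisymm this (abs_nonneg _)); linarith
      have := ties i hi j hj e
      linarith
    rcases (hs1 j).lt_or_eq with h | h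
    · obtain ⟨i, hi, ha, hb⟩ := exists_le_lt_succ (x := x) (n := n) (z := s j)
        (h0 ▸ hs0 j) (h1 ▸ h)
      exact key i hi (ha.trans_lt hb) ha hb.le
    · obtain ⟨i, hi, ha, hb⟩ := exists_lt_le_succ (x := x) (n := n) (z := s j)
        (by rw [h0, h]; norm_num) (h1 ▸ hs1 j)
      exact key i hi (ha.trans_le hb) ha.le hb
  refine ⟨h0, h1, lt, ?_, ties⟩
  intro i hi k hk z hz hz'
  simpa using cost i hi k hk (lt i hi) z hz hz'

/-! ### Client equilibria and their loads -/

theorem load_update {n : ℕ} (c : ClientChoice n) (z : unitInterval) (j k : Fin n) :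
    load (Function.update c z j) k = load c k := by
  unfold load
  refine measureReal_congr ?_
  have h : ∀ᵐ w : unitInterval, w ≠ z := by simp [ae_iff]
  refine Filter.eventuallyEq_set.2 (h.mono fun w hw => ?_)
  simp only [Set.mem_ofPred_eq, Function.update_of_ne hw]

theorem isClientEquilibrium_iff {n : ℕ} {α : ℝ} {t : Placement n} {c : ClientChoice n} :
    IsClientEquilibrium α t c ↔ IsMeasurableMapping c ∧ ∀ (z : unitInterval) (j : Fin n),
      (1 - α) * |(t (c z) : ℝ) - z| + α * load c (c z) ≤
        (1 - α) * |(t j : ℝ) - z| + α * load c j := by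
  simp only [IsClientEquilibrium, clientCost, Function.update_self, load_update]

theorem IsMeasurableMapping.measurable {n : ℕ} {c : ClientChoice n} (h : IsMeasurableMapping c) :
    Measurable c := by
  refine measurable_to_countable' fun i => ?_
  obtain ⟨J, hJ, hJ', e⟩ := h i
  change MeasurableSet {z | c z = i}
  rw [e]
  exact MeasurableSet.sUnion hJ.countable fun I hI => (hJ' I hI).measurableSet

theorem IsProperMapping.isMeasurableMapping {n : ℕ} {c : ClientChoice n} (h : IsProperMapping c) :
    IsMeasurableMapping c := fun i =>
  ⟨{{z | c z = i}}, Set.finite_singleton _, by simpa using (h i).2, by simp⟩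

theorem integral_comp_choice {n : ℕ} {c : ClientChoice n} (h : IsMeasurableMapping c)
    (g : Fin n → ℝ) : ∫ z, g (c z) = ∑ i, load c i * g i := by
  have := Measure.isProbabilityMeasure_map (μ := (volume : Measure unitInterval))
    h.measurable.aemeasurable
  rw [← integral_map (μ := volume) h.measurable.aemeasurable
    (measurable_of_finite g).aestronglyMeasurable, integral_fintype Integrable.of_finite]
  refine Finset.sum_congr rfl fun i _ => ?_
  rw [map_measureReal_apply h.measurable (measurableSet_singleton i)]
  rfl

theorem integrable_comp_choice {n : ℕ} {c : ClientChoice n} (h : IsMeasurableMapping c)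
    (g : Fin n → ℝ) : Integrable (fun z => g (c z)) (volume : Measure unitInterval) := by
  have : Integrable g (Measure.map c volume) := Integrable.of_finite
  exact this.comp_measurable h.measurable

/-- Two choices have the same loads if the difference of the loads is, for almost all clients, not
larger at the first choice than at the second. -/
theorem load_eq_of_ae_le {n : ℕ} {c c' : ClientChoice n} (h : IsMeasurableMapping c)
    (h' : IsMeasurableMapping c')
    (hle : ∀ᵐ z, load c (c z) - load c' (c z) ≤ load c (c' z) - load c' (c' z)) (i : Fin n) :
    load c i = load c' i := by
  have := integral_mono_ae (integrable_comp_choice h fun i => load c i - load c' i)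
    (integrable_comp_choice h' fun i => load c i - load c' i) hle
  rw [integral_comp_choice h fun i => load c i - load c' i,
    integral_comp_choice h' fun i => load c i - load c' i, ← sub_nonpos,
    ← Finset.sum_sub_distrib] at this
  -- With g the difference of the loads, the integral of g(c z) - g(c' z) is the sum of the squares
  -- of g.
  have h2 : ∑ i, (load c i - load c' i) ^ 2 ≤ 0 := by
    refine le_trans (le_of_eq (Finset.sum_congr rfl fun i _ => ?_)) this
    ring
  have h3 := (Finset.sum_eq_zero_iff_of_nonneg fun i _ => sq_nonneg (load c i - load c' i)).1
    (le_antisymm h2 (Finset.sum_nonneg fun i _ => sq_nonneg _)) i (Finset.mem_univ i)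
  exact sub_eq_zero.1 (pow_eq_zero_iff two_ne_zero |>.1 h3)

/-- Adding the two equilibrium conditions of a client, each against her choice in the other
equilibrium, cancels the distances and leaves loads only. -/
theorem IsClientEquilibrium.load_eq {n : ℕ} {α : ℝ} (hα : 0 < α) {t : Placement n}
    {c c' : ClientChoice n} (h : IsClientEquilibrium α t c) (h' : IsClientEquilibrium α t c')
    (i : Fin n) : load c i = load c' i := by
  rw [isClientEquilibrium_iff] at h h'
  refine load_eq_of_ae_le h.1 h'.1 (Filter.Eventually.of_forall fun z => ?_) i
  have h1 := h.2 z (c' z)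
  have h2 := h'.2 z (c z)
  refine le_of_mul_le_mul_left ?_ hα
  linarith

theorem IsClientEquilibrium.load_eq_of_sharesTies {n : ℕ} {t : Placement n}
    {c c' : ClientChoice n} (h : IsClientEquilibrium 0 t c) (h' : IsClientEquilibrium 0 t c')
    (hc : SharesTies t c) (hc' : SharesTies t c') (i : Fin n) : load c i = load c' i := by
  rw [isClientEquilibrium_iff] at h h'
  refine load_eq_of_ae_le h.1 h'.1 ?_ i
  -- Without congestion both choices are nearest facilities. Away from finitely many midpoints they
  -- are co-located, and the tie rule equalizes their loads.
  have hfin : (⋃ i, ⋃ j, {z : unitInterval | (z : ℝ) = ((t i : ℝ) + t j) / 2}).Finite :=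
    Set.finite_iUnion fun i => Set.finite_iUnion fun j => Set.Subsingleton.finite
      fun z hz w hw => Subtype.ext (hz.trans hw.symm)
  filter_upwards [hfin.countable.ae_notMem volume] with z hz
  have h1 := h.2 z (c' z)
  have h2 := h'.2 z (c z)
  have he : |(t (c z) : ℝ) - z| = |(t (c' z) : ℝ) - z| := by linarith
  rcases abs_eq_abs.1 he with h3 | h3
  · have h4 : t (c z) = t (c' z) := Subtype.ext (by linarith)
    rw [hc _ _ h4, hc' _ _ h4]
  · refine absurd ?_ hz
    simp only [Set.mem_iUnion]
    exact ⟨c z, c' z, show (z : ℝ) = _ by linarith⟩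

/-- The clients between consecutive breakpoints of a solution form a client equilibrium. -/
theorem IsSolution.exists_choice {α : ℝ} {n : ℕ} {s x : ℕ → ℝ} (h : IsSolution α n s x)
    {t : Placement n} (e : Equiv.Perm (Fin n)) (hs : ∀ j : Fin n, (t (e j) : ℝ) = s j) :
    ∃ c : ClientChoice n, IsProperMapping c ∧ SharesTies t c ∧ IsClientEquilibrium α t c ∧
      ∀ j : Fin n, load c (e j) = x (j + 1) - x j := by
  have hex : ∀ z : unitInterval, ∃ i : Fin n, x i ≤ z ∧ (z : ℝ) ≤ x (i + 1) := by
    intro z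
    rcases eq_or_lt_of_le (h.one.symm ▸ z.2.2 : (z : ℝ) ≤ x n) with hz | hz
    · obtain ⟨i, hi, h1, h2⟩ := exists_lt_le_succ (n := n) (x := x) (z := z)
        (by rw [hz, h.zero, h.one]; norm_num) hz.le
      exact ⟨⟨i, hi⟩, h1.le, h2⟩
    · obtain ⟨i, hi, h1, h2⟩ := exists_le_lt_succ (h.zero ▸ z.2.1) hz
      exact ⟨⟨i, hi⟩, h1, h2.le⟩
  choose d hd using hex
  have hmem := fun j : Fin n => h.mem_Icc j.2.le
  have hmem' := fun j : Fin n => h.mem_Icc (Nat.succ_le_of_lt j.2)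
  have hsub : ∀ j : Fin n, {z | e (d z) = e j} ⊆
      Set.Icc (⟨x j, hmem j⟩ : unitInterval) ⟨x (j + 1), hmem' j⟩ := by
    intro j z hz
    have hz : d z = j := e.injective hz
    exact hz ▸ hd z
  have hsup : ∀ j : Fin n, Set.Ioo (⟨x j, hmem j⟩ : unitInterval) ⟨x (j + 1), hmem' j⟩ ⊆
      {z | e (d z) = e j} := by
    intro j z hz
    have h1 : x j < z := hz.1
    have h2 : (z : ℝ) < x (j + 1) := hz.2
    refine congrArg e ?_
    rcases lt_trichotomy (d z) j with hlt | heq | hlt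
    · have := h.mono (Nat.succ_le_of_lt hlt) j.2.le
      have := (hd z).2
      simp only [Nat.succ_eq_add_one] at *
      linarith
    · exact heq
    · have := h.mono (Nat.succ_le_of_lt hlt) (d z).2.le
      have := (hd z).1
      simp only [Nat.succ_eq_add_one] at *
      linarith
  have hload : ∀ j : Fin n, load (fun z => e (d z)) (e j) = x (j + 1) - x j := by
    intro j
    have hnn : 0 ≤ x (j + 1) - x j := sub_nonneg.2 (h.lt j j.2).le
    refine le_antisymm ?_ ?_
    · refine (measureReal_mono (hsub j)).trans (le_of_eq ?_)
      rw [measureReal_def, unitInterval.volume_Icc, ENNReal.toReal_ofReal hnn]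
    · refine le_trans (le_of_eq ?_) (measureReal_mono (hsup j))
      rw [measureReal_def, unitInterval.volume_Ioo, ENNReal.toReal_ofReal hnn]
  have hproper : IsProperMapping fun z => e (d z) := by
    intro i
    obtain ⟨j, rfl⟩ := e.surjective i
    constructor
    · obtain ⟨y, hy1, hy2⟩ := exists_between (h.lt j j.2)
      exact ⟨⟨y, (hmem j).1.trans hy1.le, hy2.le.trans (hmem' j).2⟩, hsup j ⟨hy1, hy2⟩⟩
    · refine ⟨fun a ha b hb z hz => ?_⟩
      rcases eq_or_lt_of_le hz.1 with h1 | h1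
      · exact h1 ▸ ha
      rcases eq_or_lt_of_le hz.2 with h2 | h2
      · exact h2 ▸ hb
      exact hsup j ⟨(hsub j ha).1.trans_lt h1, h2.trans_le (hsub j hb).2⟩
  refine ⟨fun z => e (d z), hproper, ?_, ?_, hload⟩
  · intro i k hik
    obtain ⟨i, rfl⟩ := e.surjective i
    obtain ⟨k, rfl⟩ := e.surjective k
    rw [hload, hload]
    exact h.ties i i.2 k k.2 (by rw [← hs, ← hs, hik])
  · refine isClientEquilibrium_iff.2 ⟨hproper.isMeasurableMapping, fun z k => ?_⟩
    obtain ⟨k, rfl⟩ := e.surjective k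
    simp only [hload, hs]
    exact h.cost_le _ (d z).2 k k.2 z (hd z).1 (hd z).2

/-- The locations in the order given by `e`, continued by the last one. -/
def sequence {n : ℕ} (hn : 0 < n) (t : Placement n) (e : Equiv.Perm (Fin n)) (j : ℕ) : ℝ :=
  t (e ⟨min j (n - 1), by omega⟩)

theorem sequence_coe {n : ℕ} (hn : 0 < n) (t : Placement n) (e : Equiv.Perm (Fin n)) (j : Fin n) :
    sequence hn t e j = t (e j) := by
  have : (⟨min j (n - 1), by omega⟩ : Fin n) = j := Fin.ext (min_eq_left (by omega))
  rw [sequence, this]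

theorem sequence_mono {n : ℕ} (hn : 0 < n) {t : Placement n} {e : Equiv.Perm (Fin n)}
    (he : Monotone (t ∘ e)) : Monotone (sequence hn t e) := fun a b hab =>
  he (show (⟨min a (n - 1), by omega⟩ : Fin n) ≤ ⟨min b (n - 1), by omega⟩ from
    min_le_min_right _ hab)

/-- The loads of client equilibria are given by balanced breakpoints. -/
theorem exists_isSolution {α : ℝ} (hα : 0 < α) (hα1 : α ≤ 1) {n : ℕ} (hn : 0 < n)
    {t : Placement n} {e : Equiv.Perm (Fin n)} (he : Monotone (t ∘ e)) :
    ∃ x, Balanced ((1 - α) / α) n (sequence hn t e) x ∧ IsSolution α n (sequence hn t e) x ∧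
      ∀ c, IsClientEquilibrium α t c → ∀ j : Fin n, load c (e j) = x (j + 1) - x j := by
  have hβ : 0 ≤ (1 - α) / α := div_nonneg (by linarith) hα.le
  obtain ⟨x, h0, h1, hx⟩ := exists_balanced hβ (sequence_mono hn he) hn
  have hsol := hx.isSolution hα hα1 (sequence_mono hn he) (fun j => (t _).2.1)
    (fun j => (t _).2.2) h0 h1
  obtain ⟨c, -, -, hc, hload⟩ := hsol.exists_choice e fun j => (sequence_coe hn t e j).symm
  exact ⟨x, hx, hsol, fun c' hc' j => by rw [hc'.load_eq hα hc, hload]⟩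

open Filter Topology in
/-- Limits, for `α → 0`, of client equilibria. -/
theorem exists_limit_choice {n : ℕ} (hn : 0 < n) (t : Placement n) {U : Ultrafilter ℝ}
    (hU : ↑U ≤ 𝓝[>] (0 : ℝ)) :
    ∃ c : ClientChoice n, IsProperMapping c ∧ SharesTies t c ∧ IsClientEquilibrium 0 t c ∧
      ∀ C : ℝ → ClientChoice n, (∀ᶠ α in U, IsClientEquilibrium α t (C α)) →
        ∀ i, Tendsto (fun α => load (C α) i) U (𝓝 (load c i)) := by
  have he := Tuple.monotone_sort t
  set e := Tuple.sort t
  have hex : ∀ α : ℝ, ∃ x, 0 < α → α ≤ 1 → IsSolution α n (sequence hn t e) x ∧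
      ∀ c, IsClientEquilibrium α t c → ∀ j : Fin n, load c (e j) = x (j + 1) - x j := by
    intro α
    by_cases h : 0 < α ∧ α ≤ 1
    · obtain ⟨x, -, hx⟩ := exists_isSolution h.1 h.2 hn he
      exact ⟨x, fun _ _ => hx⟩
    · exact ⟨0, fun h0 h1 => absurd ⟨h0, h1⟩ h⟩
  choose X hX using hex
  have hU' : ∀ᶠ α in (U : Filter ℝ), 0 < α ∧ α ≤ 1 := by
    refine hU ?_
    filter_upwards [Ioc_mem_nhdsGT zero_lt_one] with α hα using hα
  have hsol : ∀ᶠ α in (U : Filter ℝ), IsSolution α n (sequence hn t e) (X α) :=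
    hU'.mono fun α h => (hX α h.1 h.2).1
  have hlim : ∀ j, ∃ y, j ≤ n → Tendsto (fun α => X α j) U (𝓝 y) := by
    intro j
    by_cases hj : j ≤ n
    -- Along an ultrafilter all breakpoints converge by compactness, without passing to
    -- subsequences.
    · have hc := isCompact_iff_ultrafilter_le_nhds.1 (isCompact_Icc (a := (0 : ℝ)) (b := 1))
        (U.map fun α => X α j) (le_principal_iff.2 (hsol.mono fun α h => h.mem_Icc hj))
      obtain ⟨y, -, hy⟩ := hc
      exact ⟨y, fun _ => hy⟩
    · exact ⟨0, fun h => absurd h hj⟩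
  choose x hx using hlim
  have h0 := isSolution_zero_of_tendsto (hU.trans nhdsWithin_le_nhds) (s := sequence hn t e)
    (fun j => (t _).2.1) (fun j => (t _).2.2) hsol hx
  obtain ⟨c, hc, hties, heq, hload⟩ := h0.exists_choice e fun j => (sequence_coe hn t e j).symm
  refine ⟨c, hc, hties, heq, fun C hC i => ?_⟩
  obtain ⟨j, rfl⟩ := e.surjective i
  rw [hload]
  refine ((hx (j + 1) j.2).sub (hx j j.2.le)).congr' ?_
  filter_upwards [hC, hU'] with α h1 h2
  rw [(hX α h2.1 h2.2).2 _ h1]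

open Topology in
theorem exists_choice {α : ℝ} (hα : 0 ≤ α) (hα1 : α ≤ 1) {n : ℕ} (hn : 0 < n) (t : Placement n) :
    ∃ c : ClientChoice n, IsProperMapping c ∧ SharesTies t c ∧ IsClientEquilibrium α t c := by
  rcases eq_or_lt_of_le hα with rfl | hα
  · obtain ⟨c, h1, h2, h3, -⟩ := exists_limit_choice hn t (Ultrafilter.of_le (𝓝[>] (0 : ℝ)))
    exact ⟨c, h1, h2, h3⟩
  · obtain ⟨x, -, hx, -⟩ := exists_isSolution hα hα1 hn (Tuple.monotone_sort t)
    obtain ⟨c, h1, h2, h3, -⟩ := hx.exists_choice _ fun j => (sequence_coe hn t _ j).symm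
    exact ⟨c, h1, h2, h3⟩

/-! ### The loads under the Eaton–Lipsey placements -/

/-- The sum of the first `j` numerators of the loads. -/
def loadSum (n : ℕ) : ℕ → List ℤ
  | 0 => []
  | j + 1 => padd (loadSum n j) (loadNum n j)

/-- The certificate that the tabulated loads are those of a client equilibrium. -/
def pairCheck (n : ℕ) : Bool :=
  decide (0 < numPairs n) && ppos (loadDen n) && ppos (rhoDen n) &&
  pnonneg (psub (loadSum n n) (psmul (2 * numPairs n : ℕ) (loadDen n))) &&
  pnonneg (psub (psmul (2 * numPairs n : ℕ) (loadDen n)) (loadSum n n)) &&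
  (List.range (n - 1)).all fun j =>
    -- For co-located facilities the distance terms cancel. Otherwise the breakpoint lies between
    -- the two locations, which resolves the absolute values. Polynomial identities are tested as
    -- pairs of inequalities.
    decide (pairPos n j = pairPos n (j + 1) ∧ loadNum n j = loadNum n (j + 1)) ||
    pnonneg (psub (loadSum n (j + 1)) (psmul (pairPos n j) (loadDen n))) &&
    pnonneg (psub (psmul (pairPos n (j + 1)) (loadDen n)) (loadSum n (j + 1))) &&
    pnonneg (psub (loadNum n (j + 1)) (padd (loadNum n j) (0 :: psub (psmul 2 (loadSum n (j + 1)))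
      (psmul (pairPos n j + pairPos n (j + 1)) (loadDen n))))) &&
    pnonneg (psub (padd (loadNum n j) (0 :: psub (psmul 2 (loadSum n (j + 1)))
      (psmul (pairPos n j + pairPos n (j + 1)) (loadDen n)))) (loadNum n (j + 1)))

theorem pairCheck_eq_true {n : ℕ} (hn4 : 4 ≤ n) (hn10 : n ≤ 10) : pairCheck n = true := by
  have h : ([4, 5, 6, 7, 8, 9, 10].all pairCheck) = true := by decide +kernel
  exact List.all_eq_true.1 h n (by simp only [List.mem_cons, List.not_mem_nil]; omega)

theorem pairPos_mono (n : ℕ) : Monotone (pairPos n) := by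
  intro a b hab
  have : pairIndex n a ≤ pairIndex n b := by
    unfold pairIndex
    split_ifs with h1 h2 h2
    · exact hab
    · omega
    · exact absurd (h2.imp id fun h => hab.trans_lt h) h1
    · omega
  unfold pairPos
  have := Nat.div_le_div_right (c := 2) this
  omega

theorem skip_mono (i : ℕ) : Monotone (skip i) := by
  intro a b hab
  unfold skip
  split_ifs <;> omega

theorem sPair_coe {n : ℕ} (j : Fin n) :
    ((sPair n j : unitInterval) : ℝ) = pairPos n j / (2 * numPairs n : ℕ) := by
  simp only [sPair, pairPos, Int.cast_add, Int.cast_mul, Int.cast_natCast, Int.cast_one,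
    Int.cast_ofNat, Nat.cast_mul, Nat.cast_ofNat]

theorem Balanced.mul {β : ℝ} {n : ℕ} {s x : ℕ → ℝ} (h : Balanced β n s x) {k : ℝ} (hk : 0 ≤ k) :
    Balanced β n (fun j => k * s j) (fun j => k * x j) := by
  intro j hj
  simp only [← mul_sub, abs_mul, abs_of_nonneg hk]
  rw [h j hj]
  ring

theorem Balanced.congr {β : ℝ} {n : ℕ} {s s' x : ℕ → ℝ} (h : Balanced β n s x)
    (hs : ∀ j < n, s j = s' j) : Balanced β n s' x := by
  intro j hj
  rw [← hs j (by omega), ← hs (j + 1) hj]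
  exact h j hj

/-- The partial sums of the tabulated loads are balanced breakpoints; uniqueness of equilibrium
loads does the rest. -/
theorem load_sPair {α : ℝ} (hα : 0 < α) (hα1 : α ≤ 1) {n : ℕ} (hn4 : 4 ≤ n) (hn10 : n ≤ 10)
    {c : ClientChoice n} (hc : IsClientEquilibrium α (sPair n) c) (j : Fin n) :
    load c j = peval ((1 - α) / α) (loadNum n j) /
      (peval ((1 - α) / α) (loadDen n) * (2 * numPairs n : ℕ)) := by
  have hn : 0 < n := by omega
  have hβ : 0 ≤ (1 - α) / α := div_nonneg (by linarith) hα.le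
  set β := (1 - α) / α with hβdef
  have hcheck := pairCheck_eq_true hn4 hn10
  simp only [pairCheck, Bool.and_eq_true, decide_eq_true_eq, List.all_eq_true, List.mem_range]
    at hcheck
  obtain ⟨⟨⟨⟨⟨hK, hD⟩, -⟩, ht1⟩, ht2⟩, hall⟩ := hcheck
  have hD := peval_pos hβ hD
  have ht1 := peval_nonneg hβ ht1
  have ht2 := peval_nonneg hβ ht2
  simp only [peval_psub, peval_psmul] at ht1 ht2
  have hK : (0 : ℝ) < (2 * numPairs n : ℕ) := by
    have : 0 < 2 * numPairs n := by omega
    exact_mod_cast this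
  set K : ℝ := ((2 * numPairs n : ℕ) : ℝ) with hKdef
  set D := peval β (loadDen n) with hDdef
  have hmono : Monotone (sPair n ∘ Equiv.refl (Fin n)) := by
    intro a b hab
    change ((sPair n a : unitInterval) : ℝ) ≤ sPair n b
    rw [sPair_coe, sPair_coe]
    gcongr
    exact pairPos_mono n hab
  have hseq : ∀ j < n, sequence hn (sPair n) (Equiv.refl _) j = pairPos n j / K := by
    intro j hj
    rw [show j = ((⟨j, hj⟩ : Fin n) : ℕ) from rfl, sequence_coe, Equiv.refl_apply, sPair_coe]
  have hbal : Balanced β n (fun j => (pairPos n j : ℝ)) fun j => peval β (loadSum n j) / D := by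
    intro j hj
    beta_reduce
    have e3 : peval β (loadSum n (j + 2)) =
      peval β (loadSum n (j + 1)) + peval β (loadNum n (j + 1)) := by simp [loadSum]
    have e4 : peval β (loadSum n (j + 1)) =
      peval β (loadSum n j) + peval β (loadNum n j) := by simp [loadSum]
    rcases (Bool.or_eq_true _ _).mp (hall j (by omega)) with h | h
    · obtain ⟨h1, h2⟩ := of_decide_eq_true h
      rw [h1, sub_self, mul_zero, e3, ← h2, e4]
      ring
    simp only [Bool.and_eq_true] at h
    obtain ⟨⟨⟨h1, h2⟩, h3⟩, h4⟩ := h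
    have h1 := peval_nonneg hβ h1
    have h2 := peval_nonneg hβ h2
    have h3 := peval_nonneg hβ h3
    have h4 := peval_nonneg hβ h4
    simp only [peval_psub, peval_psmul, peval_padd, peval_cons] at h1 h2 h3 h4
    push_cast at h3 h4
    have e1 : (pairPos n j : ℝ) ≤ peval β (loadSum n (j + 1)) / D := by
      rw [le_div_iff₀ hD]; linarith
    have e2 : peval β (loadSum n (j + 1)) / D ≤ (pairPos n (j + 1) : ℝ) := by
      rw [div_le_iff₀ hD]; linarith
    rw [abs_of_nonpos (sub_nonpos.2 e1), abs_of_nonneg (sub_nonneg.2 e2)]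
    rw [e3]
    have e5 : peval β (loadNum n (j + 1)) = peval β (loadNum n j) +
      β * (2 * peval β (loadSum n (j + 1)) - (pairPos n j + pairPos n (j + 1)) * D) := by
      linarith
    rw [e5, show peval β (loadNum n j) = peval β (loadSum n (j + 1)) - peval β (loadSum n j) by
      linarith]
    field_simp
    ring
  have hbal := (hbal.mul (inv_nonneg.2 hK.le)).congr (s' := sequence hn (sPair n) (Equiv.refl _))
    fun j hj => by rw [hseq j hj]; field_simp
  have hsol := hbal.isSolution hα hα1 (sequence_mono hn hmono) (fun j => (sPair n _).2.1)
    (fun j => (sPair n _).2.2) (by simp [loadSum]) (by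
      have : peval β (loadSum n n) = K * D := by
        push_cast at ht1 ht2 hKdef; rw [hKdef]; linarith
      simp only [this]; field_simp)
  obtain ⟨c', -, -, hc', hload⟩ := hsol.exists_choice (Equiv.refl _)
    fun j => (sequence_coe hn (sPair n) _ j).symm
  rw [hc.load_eq hα hc' j]
  refine (hload j).trans ?_
  have e4 : peval β (loadSum n (j + 1)) =
      peval β (loadSum n j) + peval β (loadNum n j) := by simp [loadSum]
  rw [e4]
  field_simp
  ring

/-! ### Deviations of one facility -/

theorem insertPos_mono {p : ℕ → ℤ} (hp : Monotone p) {N m : ℕ} {y : ℝ}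
    (hl : 0 < m → (p (m - 1) : ℝ) < y) (hr : m < N → y ≤ p m) {a b : ℕ} (hab : a ≤ b)
    (hb : b ≤ N) : insertPos p m y a ≤ insertPos p m y b := by
  have hp' : ∀ {a b : ℕ}, a ≤ b → (p a : ℝ) ≤ p b := fun h => by exact_mod_cast hp h
  unfold insertPos
  rcases lt_trichotomy a m with ha | rfl | ha
  · rw [if_pos ha]
    rcases lt_trichotomy b m with hb | rfl | hb
    · rw [if_pos hb]; exact hp' hab
    · rw [if_neg (lt_irrefl _), if_pos rfl]
      exact (hp' (by omega)).trans (hl (by omega)).le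
    · rw [if_neg (by omega), if_neg (by omega)]; exact hp' (by omega)
  · rw [if_neg (lt_irrefl _), if_pos rfl]
    rcases eq_or_lt_of_le hab with rfl | h
    · rw [if_neg (lt_irrefl _), if_pos rfl]
    · rw [if_neg (by omega), if_neg (by omega)]
      exact (hr (by omega)).trans (hp' (by omega))
  · rw [if_neg (by omega), if_neg (by omega), if_neg (by omega), if_neg (by omega)]
    exact hp' (by omega)

/-- The loads after one facility of the Eaton–Lipsey placement has moved. -/
theorem load_update_le {α : ℝ} (hα : 0 < α) (hα1 : α ≤ 1) {n : ℕ} (hn4 : 4 ≤ n) (hn10 : n ≤ 10)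
    {i : Fin n} {y : unitInterval} {c : ClientChoice n}
    (hc : IsClientEquilibrium α (Function.update (sPair n) i y) c) :
    load c i ≤ peval ((1 - α) / α) (rhoNum n) / peval ((1 - α) / α) (rhoDen n) *
      (peval ((1 - α) / α) (loadNum n i) /
        (peval ((1 - α) / α) (loadDen n) * (2 * numPairs n : ℕ))) := by
  obtain ⟨N, rfl⟩ : ∃ N, n = N + 1 := ⟨n - 1, by omega⟩
  have hβ : 0 ≤ (1 - α) / α := div_nonneg (by linarith) hα.le
  have hcheck := pairCheck_eq_true hn4 hn10
  simp only [pairCheck, Bool.and_eq_true, decide_eq_true_eq] at hcheck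
  obtain ⟨⟨⟨⟨⟨hK, hD⟩, hR⟩, -⟩, -⟩, -⟩ := hcheck
  have hD := peval_pos hβ hD
  have hR := peval_pos hβ hR
  have hK : (0 : ℝ) < (2 * numPairs (N + 1) : ℕ) := by
    have : 0 < 2 * numPairs (N + 1) := by omega
    exact_mod_cast this
  set p : ℕ → ℤ := fun j => pairPos (N + 1) (skip i j) with hpdef
  have hp : Monotone p := (pairPos_mono _).comp (skip_mono i)
  -- the number of other facilities to the left of the new location
  classical
  have hex : ∃ m, m = N ∨ (2 * numPairs (N + 1) : ℕ) * (y : ℝ) ≤ p m := ⟨N, Or.inl rfl⟩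
  obtain ⟨m, hmN, hl, hr⟩ : ∃ m ≤ N, (0 < m → (p (m - 1) : ℝ) < (2 * numPairs (N + 1) : ℕ) * y) ∧
      (m < N → (2 * numPairs (N + 1) : ℕ) * (y : ℝ) ≤ p m) := by
    refine ⟨Nat.find hex, Nat.find_min' hex (Or.inl rfl), fun h => ?_, fun h => ?_⟩
    · have := Nat.find_min hex (m := Nat.find hex - 1) (by omega)
      exact lt_of_not_ge fun h' => this (Or.inr h')
    · exact (Nat.find_spec hex).resolve_left h.ne
  set K := 2 * numPairs (N + 1) with hKdef
  set t := Function.update (sPair (N + 1)) i y with htdef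
  let m' : Fin (N + 1) := ⟨m, by omega⟩
  -- This permutation puts the mover at rank `m` and keeps the order of all others, so it sorts the
  -- new locations.
  let e : Equiv.Perm (Fin (N + 1)) := (finSuccEquiv' m').trans (finSuccEquiv' i).symm
  have he : e m' = i := by simp [e]
  have hte : ∀ j : Fin (N + 1), (K : ℝ) * t (e j) = insertPos p m (K * y) j := by
    intro j
    refine Fin.succAboveCases m' ?_ (fun k => ?_) j
    · rw [he]
      simp [t, insertPos, m']
    · have h1 : e (m'.succAbove k) = i.succAbove k := by simp [e]
      rw [h1, htdef, Function.update_of_ne (Fin.succAbove_ne i k), sPair_coe,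
        mul_div_cancel₀ _ hK.ne']
      have h2 : ((i.succAbove k : Fin (N + 1)) : ℕ) = skip i k := by
        unfold Fin.succAbove skip
        simp only [Fin.lt_def, Fin.val_castSucc]
        split_ifs <;> simp
      rw [h2]
      unfold Fin.succAbove insertPos
      simp only [Fin.lt_def, Fin.val_castSucc, m']
      by_cases hkm : (k : ℕ) < m
      · simp [hkm, p]
      · simp only [if_neg hkm, Fin.val_succ]
        rw [if_neg (by omega), if_neg (by omega)]
        simp [p]
  have hmono : Monotone (t ∘ e) := by
    intro a b hab
    change ((t (e a) : unitInterval) : ℝ) ≤ t (e b)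
    refine le_of_mul_le_mul_left ?_ hK
    rw [hte, hte]
    exact insertPos_mono hp hl hr hab (by omega)
  obtain ⟨x, hx, hsol, hload⟩ := exists_isSolution hα hα1 (Nat.succ_pos N) hmono
  have hbal := (hx.mul hK.le).congr (s' := insertPos p m (K * y)) fun j hj => by
    rw [← hte ⟨j, hj⟩, ← sequence_coe (Nat.succ_pos N) t e ⟨j, hj⟩]
  have hmove := moveCheck_eq_true hn4 hn10 i.2 m'.2
  have hbound := sideCheck_sound hβ hmN (K := K) (p := p) (by
      simpa only [moveCheck, Nat.add_sub_cancel, show ∀ j, N + 1 - 2 - j = N - 1 - j from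
        fun j => by omega] using hmove)
    (by rw [peval_pmul]; exact mul_pos hR hD)
    (by rw [hsol.zero, mul_zero]) (by rw [hsol.one, mul_one]; simp) hbal hl hr
  rw [peval_pmul, peval_pmul] at hbound
  have hli := hload c hc m'
  rw [he] at hli
  rw [hli]
  have hm' : (m' : ℕ) = m := rfl
  rw [hm']
  rw [← mul_sub, mul_comm, ← le_div_iff₀ hK] at hbound
  refine hbound.trans (le_of_eq ?_)
  field_simp

/-! ### The approximation factors -/

/-- The numerator of `p ((u + v * τ) / (w + z * τ))` as a polynomial in `τ`. -/
def mobius (u v w z : ℤ) : List ℤ → List ℤ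
  | [] => []
  | c :: p => padd (psmul c (p.foldr (fun _ q => pmul [w, z] q) [1]))
      (pmul [u, v] (mobius u v w z p))

theorem peval_mobius {u v w z : ℤ} {τ β : ℝ} (h : u + v * τ = β * (w + z * τ)) (p : List ℤ) :
    peval τ (mobius u v w z p) * (w + z * τ) = (w + z * τ) ^ p.length * peval β p := by
  have hpow : ∀ p : List ℤ, peval τ (p.foldr (fun _ q => pmul [w, z] q) [1]) =
      (w + z * τ) ^ p.length := by
    intro p
    induction p with
    | nil => simp
    | cons c p ih => simp [ih, pow_succ]; ring
  induction p with
  | nil => simp [mobius]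
  | cons c p ih =>
    simp only [mobius, peval_padd, peval_psmul, hpow, peval_pmul, peval_cons, peval_nil,
      List.length_cons, pow_succ]
    linear_combination (u + v * τ) * ih + (w + z * τ) ^ p.length * peval β p * h

/-- The certificate that a polynomial is nonnegative from `u / w` on, subdividing at the given
fractions. -/
def rangeCheck (p : List ℤ) : ℤ → ℤ → List (ℤ × ℤ) → Bool
  | u, w, [] => decide (0 < w) && pnonneg (mobius u 1 w 0 p)
  | u, w, (v, z) :: l =>
    decide (0 < w) && decide (0 ≤ z) && pnonneg (mobius u v w z p) && rangeCheck p v z l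

/-- The substitution β = (u + vτ) / (w + zτ) maps τ ≥ 0 onto [u/w, v/z), so nonnegative coefficients
in τ suffice there; `z = 0` with `v = 1` gives the unbounded piece. -/
theorem peval_nonneg_of_mobius {u v w z : ℤ} {β : ℝ} {p : List ℤ}
    (h : pnonneg (mobius u v w z p) = true) (hw : 0 < w) (hz : 0 ≤ z) (hu : (u : ℝ) ≤ w * β)
    (hv : z * β < v) : 0 ≤ peval β p := by
  have hw : (0 : ℝ) < w := by exact_mod_cast hw
  have hz : (0 : ℝ) ≤ z := by exact_mod_cast hz
  have hv' := sub_pos.2 hv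
  have hτ : 0 ≤ (w * β - u) / (v - z * β) := div_nonneg (sub_nonneg.2 hu) hv'.le
  set τ := (w * β - u) / (v - z * β) with hτdef
  have e : u + v * τ = β * (w + z * τ) := by
    linear_combination div_mul_cancel₀ (w * β - u) hv'.ne'
  have hpos : 0 < w + z * τ := by positivity
  have := mul_nonneg (peval_nonneg hτ h) hpos.le
  rw [peval_mobius e] at this
  exact nonneg_of_mul_nonneg_right this (pow_pos hpos _)

theorem peval_nonneg_of_rangeCheck {β : ℝ} {p : List ℤ} {l : List (ℤ × ℤ)} {u w : ℤ}
    (h : rangeCheck p u w l = true) (hu : (u : ℝ) ≤ w * β) : 0 ≤ peval β p := by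
  induction l generalizing u w with
  | nil =>
    simp only [rangeCheck, Bool.and_eq_true, decide_eq_true_eq] at h
    exact peval_nonneg_of_mobius h.2 h.1 le_rfl hu (by simp)
  | cons vz l ih =>
    obtain ⟨v, z⟩ := vz
    simp only [rangeCheck, Bool.and_eq_true, decide_eq_true_eq] at h
    obtain ⟨⟨⟨hw, hz⟩, hp⟩, hl⟩ := h
    rcases lt_or_ge ((z : ℝ) * β) v with hv | hv
    · exact peval_nonneg_of_mobius hp hw hz hu hv
    · exact ih hl hv

theorem rhoNum_le {β : ℝ} (hβ : 0 ≤ β) {n : ℕ} (hn4 : 4 ≤ n) (hn10 : n ≤ 10) :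
    100000 * peval β (rhoNum n) ≤ 108665 * peval β (rhoDen n) := by
  have h : ([4, 5, 6, 7, 8, 9, 10].all fun n =>
      rangeCheck (psub (psmul 108665 (rhoDen n)) (psmul 100000 (rhoNum n))) 0 1
        -- The subdivision is fine around β = 2/3, where for n = 7 the ratio comes within 10⁻⁵ of
        -- the bound.
        [(1, 3), (3, 5), (25, 39), (13, 19), (7, 9), (1, 1)]) = true := by decide +kernel
  have h := peval_nonneg_of_rangeCheck (β := β) (List.all_eq_true.1 h n
    (by simp only [List.mem_cons, List.not_mem_nil]; omega)) (by simpa using hβ)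
  simp only [peval_psub, peval_psmul] at h
  push_cast at h
  linarith

theorem rho_eq {α : ℝ} (hα : 0 < α) (hα1 : α ≤ 1) {n : ℕ} (hn4 : 4 ≤ n) (hn10 : n ≤ 10) :
    rho n α = peval ((1 - α) / α) (rhoNum n) / peval ((1 - α) / α) (rhoDen n) := by
  have hβ : 0 ≤ (1 - α) / α := div_nonneg (by linarith) hα.le
  have hcheck := pairCheck_eq_true hn4 hn10
  simp only [pairCheck, Bool.and_eq_true, decide_eq_true_eq] at hcheck
  have hR := (peval_pos hβ hcheck.1.1.1.2).ne'
  have h2 : α ^ 2 ≤ α := by nlinarith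
  have h3 : α ^ 3 ≤ α ^ 2 := by nlinarith [sq_nonneg α]
  have h3' : 0 < α ^ 3 := by positivity
  have h2' : 0 < α ^ 2 := by positivity
  have d8 : 16 + α * (α - 16 + α ^ 2) ≠ 0 := by
    have : 0 < 16 + α * (α - 16 + α ^ 2) := by nlinarith [sq_nonneg (1 - α)]
    exact this.ne'
  rw [eq_div_iff hR]
  have hα0 := hα.ne'
  interval_cases n
  · simp only [rho, rhoNum, rhoDen, peval_cons, peval_nil]
    push_cast
    field_simp
    ring
  · have d1 : 2 + α ≠ 0 := by positivity
    have d2 : α * (5 * α - 2) - 8 ≠ 0 := by nlinarith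
    simp only [rho]
    rw [div_mul_eq_mul_div, div_eq_iff (mul_ne_zero d1 d2)]
    simp only [rhoNum, rhoDen, peval_cons, peval_nil]
    push_cast
    field_simp
    ring
  · have d1 : α * (4 + α) - 8 ≠ 0 := by nlinarith
    simp only [rho, rhoNum, rhoDen, peval_cons, peval_nil]
    push_cast
    field_simp
    ring
  · have d1 : 32 + α * (α * (α - 10) - 16) ≠ 0 := by nlinarith
    simp only [rho, rhoNum, rhoDen, peval_cons, peval_nil]
    push_cast
    field_simp
    ring
  · simp only [rho, rhoNum, rhoDen, peval_cons, peval_nil]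
    push_cast
    field_simp
    ring
  · have d1 : α - 2 ≠ 0 := by linarith
    have d2 : 4 + α ≠ 0 := by positivity
    have d3 : 64 + α * (α * (α - 24) - 32) ≠ 0 := by nlinarith
    simp only [rho, rhoNum, rhoDen, peval_cons, peval_nil]
    push_cast
    field_simp
    ring
  · have d1 : α * (α - 4) * (α * (4 + 3 * α) - 48) - 128 ≠ 0 := by nlinarith
    simp only [rho]
    rw [div_mul_eq_mul_div, div_eq_iff (mul_ne_zero two_ne_zero d1)]
    simp only [rhoNum, rhoDen, peval_cons, peval_nil]
    push_cast
    field_simp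
    ring

theorem rho_zero {n : ℕ} (hn4 : 4 ≤ n) (hn10 : n ≤ 10) : rho n 0 = 1 := by
  interval_cases n <;> norm_num [rho]

open Filter Topology in
theorem continuousAt_rho_zero {n : ℕ} (hn4 : 4 ≤ n) (hn10 : n ≤ 10) : ContinuousAt (rho n) 0 := by
  interval_cases n <;> unfold rho <;>
    exact ContinuousAt.div (by fun_prop) (by fun_prop) (by norm_num)

theorem rho_le {α : ℝ} (hα : 0 ≤ α) (hα1 : α ≤ 1) {n : ℕ} (hn4 : 4 ≤ n) (hn10 : n ≤ 10) :
    rho n α ≤ 1.08665 := by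
  rcases eq_or_lt_of_le hα with rfl | hα
  · rw [rho_zero hn4 hn10]; norm_num
  · have hβ : 0 ≤ (1 - α) / α := div_nonneg (by linarith) hα.le
    have hcheck := pairCheck_eq_true hn4 hn10
    simp only [pairCheck, Bool.and_eq_true, decide_eq_true_eq] at hcheck
    rw [rho_eq hα hα1 hn4 hn10, div_le_iff₀ (peval_pos hβ hcheck.1.1.1.2)]
    have := rhoNum_le hβ hn4 hn10
    norm_num
    linarith

/-! ### The approximate equilibria -/

theorem load_update_le_of_pos {α : ℝ} (hα : 0 < α) (hα1 : α ≤ 1) {n : ℕ} (hn4 : 4 ≤ n)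
    (hn10 : n ≤ 10) {i : Fin n} {y : unitInterval} {c c' : ClientChoice n}
    (hc : IsClientEquilibrium α (Function.update (sPair n) i y) c)
    (hc' : IsClientEquilibrium α (sPair n) c') : load c i ≤ rho n α * load c' i := by
  rw [load_sPair hα hα1 hn4 hn10 hc', rho_eq hα hα1 hn4 hn10]
  exact load_update_le hα hα1 hn4 hn10 hc

-- Both loads and the factor are limits of their values for α → 0+, since equilibria with shared
-- ties have the same loads as the limit equilibrium.
open Filter Topology in
theorem load_update_le_of_sharesTies {n : ℕ} (hn4 : 4 ≤ n) (hn10 : n ≤ 10) {i : Fin n}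
    {y : unitInterval} {c c' : ClientChoice n}
    (hc : IsClientEquilibrium 0 (Function.update (sPair n) i y) c)
    (hct : SharesTies (Function.update (sPair n) i y) c)
    (hc' : IsClientEquilibrium 0 (sPair n) c') (hct' : SharesTies (sPair n) c') :
    load c i ≤ rho n 0 * load c' i := by
  have hn : 0 < n := by omega
  have hU := Ultrafilter.of_le (𝓝[>] (0 : ℝ))
  set U := Ultrafilter.of (𝓝[>] (0 : ℝ))
  have hU' : ∀ᶠ α in (U : Filter ℝ), 0 < α ∧ α ≤ 1 := by
    refine hU ?_
    filter_upwards [Ioc_mem_nhdsGT zero_lt_one] with α hα using hα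
  have hex : ∀ (t : Placement n) (α : ℝ), ∃ C : ClientChoice n,
      0 ≤ α → α ≤ 1 → IsClientEquilibrium α t C := by
    intro t α
    by_cases h : 0 ≤ α ∧ α ≤ 1
    · obtain ⟨C, -, -, hC⟩ := exists_choice h.1 h.2 hn t
      exact ⟨C, fun _ _ => hC⟩
    · exact ⟨c, fun h0 h1 => absurd ⟨h0, h1⟩ h⟩
  choose C hC using hex
  have hlim : ∀ (t : Placement n) (d : ClientChoice n), IsClientEquilibrium 0 t d →
      SharesTies t d → Tendsto (fun α => load (C t α) i) U (𝓝 (load d i)) := by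
    intro t d hd hdt
    obtain ⟨d', -, hdt', hd', h⟩ := exists_limit_choice hn t hU
    rw [hd.load_eq_of_sharesTies hd' hdt hdt']
    exact h (C t) (hU'.mono fun α hα => hC t α hα.1.le hα.2) i
  have hrho : Tendsto (rho n) U (𝓝 (rho n 0)) :=
    (continuousAt_rho_zero hn4 hn10).mono_left (hU.trans nhdsWithin_le_nhds)
  refine le_of_tendsto_of_tendsto (hlim _ c hc hct) (hrho.mul (hlim _ c' hc' hct')) ?_
  exact hU'.mono fun α hα => load_update_le_of_pos hα.1 hα.2 hn4 hn10
    (hC _ α hα.1.le hα.2) (hC _ α hα.1.le hα.2)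

theorem isApproxSPE_sPair {α : ℝ} (hα : 0 ≤ α) (hα1 : α ≤ 1) {n : ℕ} (hn4 : 4 ≤ n)
    (hn10 : n ≤ 10) {f : ClientStrategy n} (hf : ∀ t, IsClientEquilibrium α t (f t))
    (hties : α = 0 → ∀ t, SharesTies t (f t)) : IsApproxSPE α (rho n α) (sPair n) f := by
  refine ⟨fun i y => ?_, hf⟩
  rcases eq_or_lt_of_le hα with rfl | hα
  · exact load_update_le_of_sharesTies hn4 hn10 (hf _) (hties rfl _) (hf _) (hties rfl _)
  · exact load_update_le_of_pos hα hα1 hn4 hn10 (hf _) (hf _)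

end KohlbergGame

theorem mainTheorem1 (n : ℕ) (hn4 : 4 ≤ n) (hn10 : n ≤ 10) (α : ℝ) (hα0 : 0 ≤ α) (hα1 : α ≤ 1) :
    (∃ f : KohlbergGame.ClientStrategy n,
      (∀ t : KohlbergGame.Placement n, KohlbergGame.IsProperMapping (f t)) ∧
      (∀ t : KohlbergGame.Placement n, KohlbergGame.SharesTies t (f t)) ∧
      KohlbergGame.IsApproxSPE α (KohlbergGame.rho n α) (KohlbergGame.sPair n) f) ∧
    (∀ f : KohlbergGame.ClientStrategy n,
      (∀ t : KohlbergGame.Placement n, KohlbergGame.IsClientEquilibrium α t (f t)) →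
      (α = 0 → ∀ t : KohlbergGame.Placement n, KohlbergGame.SharesTies t (f t)) →
      KohlbergGame.IsApproxSPE α (KohlbergGame.rho n α) (KohlbergGame.sPair n) f) ∧
    KohlbergGame.rho n α ≤ 1.08665 := by
  choose f hproper hties hf using fun t : KohlbergGame.Placement n =>
    KohlbergGame.exists_choice hα0 hα1 (by omega) t
  exact ⟨⟨f, hproper, hties, KohlbergGame.isApproxSPE_sPair hα0 hα1 hn4 hn10 hf fun _ => hties⟩,
    fun f hf hties => KohlbergGame.isApproxSPE_sPair hα0 hα1 hn4 hn10 hf hties,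
    KohlbergGame.rho_le hα0 hα1 hn4 hn10⟩
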